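/- Let $L\ge 2$ and fix dimensions $d,N$ and $m\ge1$, data $x\in\mathbb R^{d\times N}$, $y\in\mathbb R^{m\times N}$ and $\sigma>0$. For each hidden width $M$ consider the linear network $u_0=x$, $u_l=W_lu_{l-1}$ $(1\le l\le L)$, $f=u_L$, with $W_1\in\mathbb R^{M\times d}$, $W_l\in\mathbb R^{M\times M}$ $(1<l<L)$, $W_L\in\mathbb R^{m\times M}$, and write $W_{L:i}=W_L\cdots W_i$, $W_{L:L+1}=I$. The weights are random with the $\mu$P scaling: $W_l=w_l/M^{a_l}$, where for each $M$ all entries of $w_1,\dots,w_L$ are independent, those of $w_l$ are $\mathcal N(0,\sigma^2/M^{2b_l})$, and $a_1+b_1=0$, $a_l+b_l=\tfrac12$ $(1<l<L)$, $a_L+b_L=1$. The joint law for different $M$ is arbitrary. The step sizes $\gamma_1,\dots,\gamma_L>0$ may depend on $M$, and $\gamma_l=\Theta(1)$ for $l<L$ as $M\to\infty$. Norms are Frobenius norms. Predictive coding (PC) with squared loss has the free energy $$\mathcal F(v,W)=\tfrac{\gamma_L}2\|y-W_Lv_{L-1}\|^2+\sum_{l=1}^{L-1}\tfrac{\gamma_l}{2}\|v_l-W_lv_{l-1}\|^2,\qquad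 v_0=x,\ v_L=y,$$ and its inference phase is $v_l\mapsto v_l-\gamma_le_l+\gamma_{l+1}W_{l+1}^\top e_{l+1}$ $(1\le l<L)$ with $e_l=v_l-W_lv_{l-1}$. Put $$C_\gamma=\sum_{i=2}^L\frac{\gamma_L}{\gamma_{i-1}}W_{L:i}W_{L:i}^\top,\quad \mathcal L(W)=\tfrac12\|y-W_{L:1}x\|^2,\quad \delta_l=W_{L:l+1}^\top(y-f).$$ The inference phase has exactly one fixed point $v^*$ (with errors $e^*_l$), and the following hold as $M\to\infty$. 1. Suppose $\gamma_L=\Theta(1)$. Then $C_\gamma=O(1/M)$: there is a deterministic $K$ such that almost surely $\|C_\gamma\|\le K/M$ for all large $M$. Moreover the gradient that PC uses at the fixed point reduces to that of first-order gradient descent: almost surely, - $\|\gamma_le^*_l-\gamma_L\delta_l\|=o(\|\delta_l\|)$ for $1\le l\le L$; - the root mean square of the entries of $v^*_l-u_l$ tends to $0$ for $0\le l<L$; - for $1\le l\le L$, with $s_l=1/M$ if $l<L$ and $s_L=1$, the root mean square of the entries of $\partial_{W_l}\mathcal F(v^*,W)-\gamma_L\,\partial_{W_l}\mathcal L(W)$,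 divided by $s_l$, tends to $0$; - if $yx^\top\ne0$, then $\|\partial_{W_l}\mathcal F(v^*,W)-\gamma_L\,\partial_{W_l}\mathcal L(W)\|=o(\|\partial_{W_l}\mathcal L(W)\|)$ for $1\le l\le L$. 2. Suppose $\gamma_L=\Theta(M)$. Then $C_\gamma$ stays of order $1$: there are deterministic constants $0<c\le K$ such that almost surely $c\le\|C_\gamma\|\le K$ for all large $M$. -/

import Mathlib

open MeasureTheory ProbabilityTheory Filter Topology Asymptotics
open scoped Matrix Matrix.Norms.Frobenius

noncomputable section

namespace PCNet

/-- Weights of a fully connected network whose layer `l` has width `n l` (layer `0` is the input).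
Everything attached to the connection from layer `l` to layer `l + 1` carries the index `l`, so
`W l` is the matrix usually written `W_{l+1}`. A network with `H` hidden layers has the connections
`0, …, H`, that is `L = H + 1` weight matrices; entries with larger index are never used. -/
abbrev Weights (n : ℕ → ℕ) : Type := ∀ l : ℕ, Matrix (Fin (n (l + 1))) (Fin (n l)) ℝ

/-- Internal states `v l` of the layers `0, …, H + 1`, one column for each of the `N` samples. -/
abbrev States (n : ℕ → ℕ) (N : ℕ) : Type := ∀ l : ℕ, Matrix (Fin (n l)) (Fin N) ℝ

variable {n : ℕ → ℕ} {N : ℕ}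

/-- The product `W (j-1) * ⋯ * W i` carrying layer `i` to layer `j`, for `i ≤ j`
(the identity matrix when `i = j`). In one-based notation this is `W_{j:i+1}`. -/
def weightProd (W : Weights n) : ∀ j i : ℕ, Matrix (Fin (n j)) (Fin (n i)) ℝ
  | 0, _ => Matrix.of fun a b => if (a : ℕ) = (b : ℕ) then 1 else 0
  | j + 1, i =>
    if i ≤ j then W j * weightProd W j i
    else Matrix.of fun a b => if (a : ℕ) = (b : ℕ) then 1 else 0

/-- The forward pass of the linear network, `u_l = W_{l:1} x`. -/
def forward (W : Weights n) (x : Matrix (Fin (n 0)) (Fin N) ℝ) (l : ℕ) :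
    Matrix (Fin (n l)) (Fin N) ℝ :=
  weightProd W l 0 * x

/-- Mean squared error; `‖·‖` is the Frobenius norm throughout. -/
def squaredLoss {m : ℕ} (y p : Matrix (Fin m) (Fin N) ℝ) : ℝ := 1 / 2 * ‖y - p‖ ^ 2

/-- The training loss of the linear network with `H` hidden layers, as a function of the weights. -/
def trainLoss (H : ℕ) (x : Matrix (Fin (n 0)) (Fin N) ℝ) (y : Matrix (Fin (n (H + 1))) (Fin N) ℝ)
    (W : Weights n) : ℝ :=
  squaredLoss y (forward W x (H + 1))

/-- The local prediction error `e_{l+1} = v_{l+1} - W_{l+1} v_l`. -/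
def localError (W : Weights n) (v : States n N) (l : ℕ) : Matrix (Fin (n (l + 1))) (Fin N) ℝ :=
  v (l + 1) - W l * v l

/-- The free energy of predictive coding,
`γ_L ℒ(y, W_L v_{L-1}) + ∑_{l=1}^{L-1} γ_l ‖v_l - W_l v_{l-1}‖² / 2`. -/
def freeEnergy (H : ℕ) (γ : ℕ → ℝ) (y : Matrix (Fin (n (H + 1))) (Fin N) ℝ) (v : States n N)
    (W : Weights n) : ℝ :=
  γ H * squaredLoss y (W H * v H) +
    ∑ l ∈ Finset.range H, γ l * (1 / 2 * ‖localError W v l‖ ^ 2)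

/-- One step of the inference phase (gradient descent on the free energy in the hidden states):
the input layer `0` and the output layer `H + 1` stay clamped, and the hidden layers
`1, …, H` are updated by `v_l ↦ v_l - γ_l e_l + γ_{l+1} W_{l+1}ᵀ e_{l+1}`. -/
def inferenceStep (H : ℕ) (γ : ℕ → ℝ) (W : Weights n) (v : States n N) : States n N
  | 0 => v 0
  | l + 1 =>
    if l < H then
      v (l + 1) - γ l • localError W v l + γ (l + 1) • ((W (l + 1))ᵀ * localError W v (l + 1))
    else v (l + 1)

/-- Fixed points of the inference phase for the data `(x, y)`: `v_0 = x`, `v_L = y`. -/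
def IsInferenceFixedPoint (H : ℕ) (γ : ℕ → ℝ) (W : Weights n)
    (x : Matrix (Fin (n 0)) (Fin N) ℝ) (y : Matrix (Fin (n (H + 1))) (Fin N) ℝ)
    (v : States n N) : Prop :=
  v 0 = x ∧ v (H + 1) = y ∧ Function.IsFixedPt (inferenceStep H γ W) v

/-- The gradient `∂J/∂W_{l+1}`, the matrix of partial derivatives of `J` in the entries of `W l`. -/
def weightGrad (J : Weights n → ℝ) (W : Weights n) (l : ℕ) :
    Matrix (Fin (n (l + 1))) (Fin (n l)) ℝ :=
  Matrix.of fun i j =>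
    deriv (fun t : ℝ => J (Function.update W l (W l + t • Matrix.single i j (1 : ℝ)))) 0

/-- The gradient used in the learning phase of predictive coding: the gradient of the free energy
in the weights, with the states held fixed. -/
def pcGrad (H : ℕ) (γ : ℕ → ℝ) (y : Matrix (Fin (n (H + 1))) (Fin N) ℝ) (v : States n N)
    (W : Weights n) (l : ℕ) : Matrix (Fin (n (l + 1))) (Fin (n l)) ℝ :=
  weightGrad (freeEnergy H γ y v) W l

/-- The gradient used by first-order gradient descent. -/
def gdGrad (H : ℕ) (x : Matrix (Fin (n 0)) (Fin N) ℝ) (y : Matrix (Fin (n (H + 1))) (Fin N) ℝ)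
    (W : Weights n) (l : ℕ) : Matrix (Fin (n (l + 1))) (Fin (n l)) ℝ :=
  weightGrad (trainLoss H x y) W l

/-- The backpropagated error `W_{L:l+2}ᵀ (y - f)` at layer `l + 1`, i.e. minus the gradient of the
loss in the preactivation `u_{l+1}`. -/
def backpropError (H : ℕ) (x : Matrix (Fin (n 0)) (Fin N) ℝ)
    (y : Matrix (Fin (n (H + 1))) (Fin N) ℝ) (W : Weights n) (l : ℕ) :
    Matrix (Fin (n (l + 1))) (Fin N) ℝ :=
  (weightProd W (H + 1) (l + 1))ᵀ * (y - forward W x (H + 1))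

/-- The preconditioner part `C_γ(W) = ∑_{i=2}^{L} (γ_L / γ_{i-1}) W_{L:i} W_{L:i}ᵀ`
(here `i = l + 2`). -/
def precond (H : ℕ) (γ : ℕ → ℝ) (W : Weights n) :
    Matrix (Fin (n (H + 1))) (Fin (n (H + 1))) ℝ :=
  ∑ l ∈ Finset.range H, (γ H / γ l) •
    (weightProd W (H + 1) (l + 1) * (weightProd W (H + 1) (l + 1))ᵀ)

/-- Root mean square of the entries of a matrix. -/
def rms {p q : ℕ} (A : Matrix (Fin p) (Fin q) ℝ) : ℝ := ‖A‖ / Real.sqrt ((p : ℝ) * (q : ℝ))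

/-- Layer widths: input dimension `d`, hidden layers `1, …, H` of width `M`, output dimension `m`. -/
def width (H d m M : ℕ) (l : ℕ) : ℕ := if l = 0 then d else if l ≤ H then M else m

theorem width_zero (H d m M : ℕ) : width H d m M 0 = d := by simp [width]

theorem width_last (H d m M : ℕ) : width H d m M (H + 1) = m := by simp [width]

/-- Input data, independent of the width, as states of layer `0`. -/
def inputData (H m M : ℕ) {d : ℕ} (x : Matrix (Fin d) (Fin N) ℝ) :
    Matrix (Fin (width H d m M 0)) (Fin N) ℝ :=
  x.submatrix (Fin.cast (width_zero H d m M)) id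

/-- Targets, independent of the width, as states of layer `H + 1`. -/
def outputData (H d M : ℕ) {m : ℕ} (y : Matrix (Fin m) (Fin N) ℝ) :
    Matrix (Fin (width H d m M (H + 1))) (Fin N) ℝ :=
  y.submatrix (Fin.cast (width_last H d m M)) id

/-- `w M` are the unscaled random weights at hidden width `M`: all entries are independent, and those
of `w_{l+1}` have law `N(0, σ² / M^{2 b_{l+1}})`. Nothing is assumed about the joint law
for different `M`. -/
def IsGaussianInit {Ω : Type*} [MeasurableSpace Ω] (μ : Measure Ω) (H d m : ℕ) (σ : ℝ) (b : ℕ → ℝ)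
    (w : ∀ M : ℕ, Ω → Weights (width H d m M)) : Prop :=
  ∀ M : ℕ,
    (∀ l ≤ H, ∀ i j, HasLaw (fun ω => w M ω l i j)
      (gaussianReal 0 (Real.toNNReal (σ ^ 2 / (M : ℝ) ^ (2 * b l)))) μ) ∧
    iIndepFun (fun (p : Σ l : Fin (H + 1),
        Fin (width H d m M ((l : ℕ) + 1)) × Fin (width H d m M (l : ℕ))) (ω : Ω) =>
      w M ω (p.1 : ℕ) p.2.1 p.2.2) μ

/-- The weights of the abc-parameterization, `W_l = w_l / M^{a_l}`. -/
def scaledWeights {n : ℕ → ℕ} (M : ℕ) (a : ℕ → ℝ) (w : Weights n) : Weights n :=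
  fun l => ((M : ℝ) ^ (a l))⁻¹ • w l

/-- The scale of the initial weights in the maximal update parameterization: `a_1 + b_1 = 0` for the
input layer, `a_l + b_l = 1/2` for `1 < l < L`, and `a_L + b_L = 1` for the output layer. -/
def IsMuPScale (H : ℕ) (a b : ℕ → ℝ) : Prop :=
  a 0 + b 0 = 0 ∧ (∀ l, 1 ≤ l → l < H → a l + b l = 1 / 2) ∧ a H + b H = 1

end PCNet

end

open PCNet

/-! At a fixed point the balance equations chain downwards, so every error is the output error
propagated backwards: γ_l e_l = γ_L W_{L:l+1}ᵀ e_L (`IsInferenceFixedPoint.error_eq`). Unrolling the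
states from the input turns v_L = y into (I + C_γ) e_L = y - f (`residual_eq`). Since C_γ is
positive semidefinite, I + C_γ does not decrease norms. Hence it is bijective, which gives existence
and uniqueness, and ‖e_L‖ ≤ ‖y - f‖. The deviation from backpropagation is exactly -γ_L W_{L:l+1}ᵀ
C_γ e_L, so what remains is to measure products of weights.

A Gaussian matrix with M rows and entry variance s, applied to an independent vector, multiplies its
squared norm by M s up to a relative error that is large only with exponentially small probability
(`IsGaussianMatrix.deviation`). Peeling off one layer at a time, and polarizing over the fixed input
and output dimensions, makes W_{L:l}ᵀ comparable to M^(-1/2) times an isometry and W_{l:1}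
comparable to M^(1/2) times one, for hidden layers l. The difference v_l - u_l depends on all the
weights, so it needs an operator norm bound, obtained from a net. The matrix W_1ᵀ has only d rows
and does not concentrate, but losing a factor √M in the squared norm still leaves W_{L:1} → 0, hence
f → 0. All failure probabilities are summable in M, so the first Borel–Cantelli lemma suffices for
any joint law. The outcome is `WellConditioned`; everything after it is deterministic.

Consequently C_γ has order γ_L / M, which covers both regimes. The bounded condition number of
W_{L:l+1}ᵀ turns ‖C_γ‖ = O(1/M) into an error relative to δ_l. The two gradients are -γ_l e_l v_lᵀ
and -δ_l u_lᵀ, with u_l = O(√M) and v_l - u_l = O(1/√M), so they differ (after scaling by γ_L) by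
O(‖δ_l‖/√M). If yxᵀ ≠ 0, then f → 0 keeps (y - f)xᵀ away from 0, and the gradient of the loss
dominates a multiple of ‖δ_l‖. -/

namespace PCNet

/-! ### Gaussian vectors -/

open scoped NNReal ENNReal

/-- A linear combination of independent centred Gaussian variables of common variance. -/
theorem hasLaw_sum_mul_gaussian {Ω ι : Type*} [MeasurableSpace Ω] {P : Measure Ω}
    [IsProbabilityMeasure P] {X : ι → Ω → ℝ} {s : ℝ≥0}
    (hX : ∀ i, HasLaw (X i) (gaussianReal 0 s) P) (hind : iIndepFun X P) (v : ι → ℝ)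
    (S : Finset ι) :
    HasLaw (fun ω => ∑ i ∈ S, v i * X i ω) (gaussianReal 0 (s * ∑ i ∈ S, (v i ^ 2).toNNReal)) P := by
  classical
  induction S using Finset.induction_on with
  | empty =>
    refine ⟨by fun_prop, ?_⟩
    simp [gaussianReal_zero_var, Measure.map_const]
  | insert i S hi ih =>
    have hm : ∀ i, AEMeasurable (fun ω => v i * X i ω) P :=
      fun i => (hX i).aemeasurable.const_mul _
    have hind' : iIndepFun (fun i ω => v i * X i ω) P :=
      hind.comp (fun i x => v i * x) (fun i => by fun_prop)
    have h1 := gaussianReal_const_mul (hX i) (v i)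
    have h2 := (hind'.indepFun_finsetSum_of_notMem₀ hm hi).symm
    have hs : (∑ j ∈ S, fun ω => v j * X j ω) = fun ω => ∑ j ∈ S, v j * X j ω := by
      ext ω; simp
    rw [hs] at h2
    have h3 := gaussianReal_add_gaussianReal_of_indepFun h2 h1.map_eq ih.map_eq
    refine ⟨?_, ?_⟩
    · simp only [Finset.sum_insert hi]
      exact (hm i).add ih.aemeasurable
    · have : (fun ω => ∑ j ∈ insert i S, v j * X j ω)
          = (fun ω => v i * X i ω) + fun ω => ∑ j ∈ S, v j * X j ω := by
        ext ω; simp [Finset.sum_insert hi]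
      rw [this, h3]
      congr 1
      · simp
      · rw [Finset.sum_insert hi, mul_add, mul_comm s (v i ^ 2).toNNReal]
        congr 2
        ext
        simp [sq_nonneg (v i)]

/-- The entries of `G` are independent, centred Gaussian of variance `s`. -/
structure IsGaussianMatrix {Ω : Type*} [MeasurableSpace Ω] (P : Measure Ω) {p q : ℕ} (s : ℝ≥0)
    (G : Ω → Matrix (Fin p) (Fin q) ℝ) : Prop where
  law : ∀ i j, HasLaw (fun ω => G ω i j) (gaussianReal 0 s) P
  indep : iIndepFun (fun (ij : Fin p × Fin q) ω => G ω ij.1 ij.2) P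

theorem IsGaussianMatrix.transpose {Ω : Type*} [MeasurableSpace Ω] {P : Measure Ω} {p q : ℕ}
    {s : ℝ≥0} {G : Ω → Matrix (Fin p) (Fin q) ℝ} (hG : IsGaussianMatrix P s G) :
    IsGaussianMatrix P s (fun ω => (G ω)ᵀ) :=
  ⟨fun i j => hG.law j i, hG.indep.precomp Prod.swap_injective⟩

/-- The image of a fixed vector under a Gaussian matrix has independent Gaussian entries. -/
theorem IsGaussianMatrix.hasLaw_mulVec {Ω : Type*} [MeasurableSpace Ω] {P : Measure Ω}
    [IsProbabilityMeasure P] {p q : ℕ}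
    {s : ℝ≥0} {G : Ω → Matrix (Fin p) (Fin q) ℝ} (hG : IsGaussianMatrix P s G) (v : Fin q → ℝ) :
    HasLaw (fun ω => G ω *ᵥ v)
      (Measure.pi fun _ : Fin p => gaussianReal 0 (s * ∑ i, (v i ^ 2).toNNReal)) P := by
  have hm : AEMeasurable (fun ω (ij : Fin p × Fin q) => G ω ij.1 ij.2) P :=
    aemeasurable_pi_lambda _ fun ij => (hG.law _ _).aemeasurable
  have h0 := (iIndepFun_iff_map_fun_eq_infinitePi_map₀ hm).1 hG.indep
  simp only [(hG.law _ _).map_eq] at h0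
  -- Currying the joint law of the entries exhibits the rows as independent vectors, so the
  -- coordinates of the image are independent.
  have h1 := Measure.infinitePi_map_curry (ι := Fin p) (κ := Fin q)
    (fun _ _ => gaussianReal 0 s)
  rw [← h0, AEMeasurable.map_map_of_aemeasurable (by fun_prop) hm] at h1
  simp only [Measure.infinitePi_eq_pi] at h1
  have h2 : HasLaw (fun z : Fin q → ℝ => ∑ j, v j * z j)
      (gaussianReal 0 (s * ∑ i, (v i ^ 2).toNNReal))
      (Measure.pi fun _ : Fin q => gaussianReal 0 s) := by
    refine hasLaw_sum_mul_gaussian (X := fun j (z : Fin q → ℝ) => z j) (fun i => ?_) ?_ v Finset.univ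
    · exact ⟨(measurable_pi_apply i).aemeasurable, (measurePreserving_eval _ i).map_eq⟩
    · exact iIndepFun_pi (X := fun _ x => x) (fun i => aemeasurable_id)
  have h3 : Measurable fun (z : Fin p → Fin q → ℝ) (i : Fin p) => ∑ j, v j * z i j := by
    fun_prop
  have h4 := Measure.pi_map_pi (μ := fun _ : Fin p => Measure.pi fun _ : Fin q => gaussianReal 0 s)
    (f := fun (_ : Fin p) (z : Fin q → ℝ) => ∑ j, v j * z j)
    (fun i => Measurable.aemeasurable (by fun_prop))
  simp only [h2.map_eq] at h4
  have hc : (fun ω => G ω *ᵥ v) = (fun (z : Fin p → Fin q → ℝ) (i : Fin p) => ∑ j, v j * z i j) ∘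
      (MeasurableEquiv.curry (Fin p) (Fin q) ℝ) ∘ fun ω (ij : Fin p × Fin q) => G ω ij.1 ij.2 := by
    ext ω i
    simp [Matrix.mulVec, dotProduct, MeasurableEquiv.curry, Function.curry, mul_comm]
  have hm' : AEMeasurable (⇑(MeasurableEquiv.curry (Fin p) (Fin q) ℝ) ∘
      fun ω (ij : Fin p × Fin q) => G ω ij.1 ij.2) P :=
    (MeasurableEquiv.measurable _).comp_aemeasurable hm
  refine ⟨?_, ?_⟩
  · rw [hc]; exact h3.comp_aemeasurable hm'
  · rw [hc, ← AEMeasurable.map_map_of_aemeasurable h3.aemeasurable hm', h1, h4]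

/-! ### Tails of sums of squares -/

theorem gaussian_exp_sq (τ : ℝ≥0) {t : ℝ} (ht : 2 * t * τ < 1) :
    Integrable (fun z : ℝ => Real.exp (t * z ^ 2)) (gaussianReal 0 τ) ∧
    ∫ z, Real.exp (t * z ^ 2) ∂(gaussianReal 0 τ) = (√(1 - 2 * t * τ))⁻¹ := by
  rcases eq_or_ne τ 0 with rfl | hτ
  · simp only [gaussianReal_zero_var]
    exact ⟨integrable_dirac (by simp), by simp⟩
  have hτ' : 0 < (τ : ℝ) := by positivity
  set b : ℝ := (1 - 2 * t * τ) / (2 * τ) with hb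
  have hb0 : 0 < b := div_pos (by linarith) (by positivity)
  have key : ∀ z : ℝ, gaussianPDFReal 0 τ z * Real.exp (t * z ^ 2)
      = (√(2 * Real.pi * τ))⁻¹ * Real.exp (-b * z ^ 2) := by
    intro z
    rw [gaussianPDFReal, mul_assoc, ← Real.exp_add]
    congr 2
    rw [hb]; field_simp; ring
  constructor
  · rw [gaussianReal_of_var_ne_zero _ hτ,
      integrable_withDensity_iff (measurable_gaussianPDF _ _)
        (ae_of_all _ fun _ => gaussianPDF_lt_top)]
    simp only [toReal_gaussianPDF]
    simp_rw [mul_comm (Real.exp _), key]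
    exact (integrable_exp_neg_mul_sq hb0).const_mul _
  · rw [integral_gaussianReal_eq_integral_smul hτ]
    simp only [smul_eq_mul, key]
    rw [integral_const_mul, integral_gaussian, ← Real.sqrt_inv, ← Real.sqrt_inv,
      ← Real.sqrt_mul (by positivity)]
    congr 1
    rw [hb]
    have : 1 - 2 * t * τ ≠ 0 := by linarith
    field_simp

theorem pi_gaussian_exp_sum_sq (p : ℕ) (τ : ℝ≥0) {t : ℝ} (ht : 2 * t * τ < 1) :
    Integrable (fun z : Fin p → ℝ => Real.exp (t * ∑ i, z i ^ 2))
      (Measure.pi fun _ => gaussianReal 0 τ) ∧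
    mgf (fun z : Fin p → ℝ => ∑ i, z i ^ 2) (Measure.pi fun _ => gaussianReal 0 τ) t
      = (√(1 - 2 * t * τ))⁻¹ ^ p := by
  have he : ∀ z : Fin p → ℝ, Real.exp (t * ∑ i, z i ^ 2) = ∏ i, Real.exp (t * z i ^ 2) := by
    intro z; rw [Finset.mul_sum, Real.exp_sum]
  obtain ⟨h1, h2⟩ := gaussian_exp_sq τ ht
  simp only [mgf, he]
  constructor
  · exact Integrable.fintype_prod (f := fun _ z => Real.exp (t * z ^ 2)) fun _ => h1
  · rw [integral_fintype_prod_eq_prod (f := fun _ z => Real.exp (t * z ^ 2))]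
    simp [h2]

/-- This is -log(1 - θ) ≤ θ + θ². For θ ≤ 0 the linear bound on exp is enough, as (1 - θ)(1 + θ +
θ²) = 1 - θ³ ≥ 1; for θ ≥ 0 the quadratic term is needed. -/
theorem inv_sqrt_one_sub_le {θ : ℝ} (h2 : θ ≤ 1 / 2) :
    (√(1 - θ))⁻¹ ≤ Real.exp ((θ + θ ^ 2) / 2) := by
  have h : 1 ≤ (1 - θ) * Real.exp (θ + θ ^ 2) := by
    rcases le_total 0 θ with h | h
    · have := Real.quadratic_le_exp_of_nonneg (x := θ + θ ^ 2) (by positivity)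
      nlinarith [mul_nonneg (sub_nonneg.2 h2) h, mul_nonneg h h, mul_nonneg (mul_nonneg h h) h,
        mul_nonneg (sub_nonneg.2 h2) (mul_nonneg h h),
        mul_nonneg (sub_nonneg.2 h2) (mul_nonneg (mul_nonneg h h) h),
        mul_nonneg (sub_nonneg.2 h2) (mul_nonneg (mul_nonneg h h) (mul_nonneg h h)),
        mul_le_mul_of_nonneg_left this (by linarith : 0 ≤ 1 - θ)]
    · have := Real.add_one_le_exp (θ + θ ^ 2)
      have h3 := mul_le_mul_of_nonneg_left this (by linarith : 0 ≤ 1 - θ)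
      nlinarith [mul_nonneg (neg_nonneg.2 h) (sq_nonneg θ)]
  rw [← Real.sqrt_inv]
  refine Real.sqrt_le_iff.2 ⟨by positivity, ?_⟩
  rw [← Real.exp_nat_mul]
  have e : ((2 : ℕ) : ℝ) * ((θ + θ ^ 2) / 2) = θ + θ ^ 2 := by push_cast; ring
  rw [e, inv_le_iff_one_le_mul₀' (by linarith)]
  exact h

/-- Chernoff's method with exponent t = θ / (2τ), which removes the variance from the bound; the
sign of θ selects the tail. -/
theorem chiSq_chernoff (p : ℕ) {τ : ℝ≥0} (hτ : 0 < τ) {θ : ℝ} (h2 : θ ≤ 1 / 2)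
    (R : ℝ) :
    (0 ≤ θ → (Measure.pi fun _ : Fin p => gaussianReal 0 τ).real {z | R * τ ≤ ∑ i, z i ^ 2}
      ≤ Real.exp (p * ((θ + θ ^ 2) / 2) - θ * R / 2)) ∧
    (θ ≤ 0 → (Measure.pi fun _ : Fin p => gaussianReal 0 τ).real {z | ∑ i, z i ^ 2 ≤ R * τ}
      ≤ Real.exp (p * ((θ + θ ^ 2) / 2) - θ * R / 2)) := by
  have hτ' : (τ : ℝ) ≠ 0 := by exact_mod_cast hτ.ne'
  have hpos : (0 : ℝ) < τ := by exact_mod_cast hτ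
  set t : ℝ := θ / (2 * τ) with ht
  have htτ : 2 * t * τ = θ := by rw [ht]; field_simp
  obtain ⟨hi, hm⟩ := pi_gaussian_exp_sum_sq p τ (t := t) (by rw [htτ]; linarith)
  rw [htτ] at hm
  have hb : Real.exp (-t * (R * τ)) * mgf (fun z : Fin p → ℝ => ∑ i, z i ^ 2)
      (Measure.pi fun _ => gaussianReal 0 τ) t ≤ Real.exp (p * ((θ + θ ^ 2) / 2) - θ * R / 2) := by
    rw [hm]
    have e : -t * (R * τ) = - (θ * R / 2) := by rw [← htτ]; ring
    rw [e, sub_eq_neg_add (p * ((θ + θ ^ 2) / 2)), Real.exp_add, Real.exp_nat_mul]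
    gcongr
    exact inv_sqrt_one_sub_le h2
  constructor
  · intro h
    exact (measure_ge_le_exp_mul_mgf _ (by rw [ht]; positivity) hi).trans hb
  · intro h
    exact (measure_le_le_exp_mul_mgf _ (by
      rw [ht]; exact div_nonpos_of_nonpos_of_nonneg h (by positivity)) hi).trans hb

theorem pi_gaussian_zero_sum_sq (p : ℕ) :
    ∀ᵐ z ∂(Measure.pi fun _ : Fin p => gaussianReal 0 0), ∑ i, z i ^ 2 = 0 := by
  have h : ∀ᵐ z ∂(Measure.pi fun _ : Fin p => gaussianReal 0 0), ∀ i, z i = 0 := by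
    refine ae_all_iff.2 fun i => ?_
    refine (measurePreserving_eval (fun _ : Fin p => gaussianReal 0 0)
      i).quasiMeasurePreserving.ae (p := fun x => x = 0) ?_
    rw [gaussianReal_zero_var, ae_dirac_eq]
    simp
  filter_upwards [h] with z hz
  simp [hz]

theorem chiSq_deviation (p : ℕ) (τ : ℝ≥0) {ε : ℝ} (h0 : 0 < ε) (h1 : ε ≤ 1) :
    (Measure.pi fun _ : Fin p => gaussianReal 0 τ).real
      {z | ε * (p * τ) < |∑ i, z i ^ 2 - p * τ|} ≤ 2 * Real.exp (-(p * ε ^ 2 / 8)) := by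
  -- The variance will be s‖v‖², which vanishes for v = 0; the strict inequality in the event then
  -- fails almost surely.
  rcases eq_or_ne τ 0 with rfl | hτ
  · refine le_trans (le_of_eq ?_) (by positivity : (0 : ℝ) ≤ _)
    rw [measureReal_eq_zero_iff, measure_eq_zero_iff_ae_notMem]
    filter_upwards [pi_gaussian_zero_sum_sq p] with z hz
    simp [hz]
  have hτ := pos_iff_ne_zero.2 hτ
  -- With θ = ±ε/2 the first-order terms cancel and both exponents equal -pε²/8.
  have hu := (chiSq_chernoff p hτ (θ := ε / 2) (by linarith) ((1 + ε) * p)).1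
    (by linarith)
  have hl := (chiSq_chernoff p hτ (θ := -(ε / 2)) (by linarith) ((1 - ε) * p)).2
    (by linarith)
  have e1 : (p : ℝ) * ((ε / 2 + (ε / 2) ^ 2) / 2) - ε / 2 * ((1 + ε) * p) / 2
      = -(p * ε ^ 2 / 8) := by ring
  have e2 : (p : ℝ) * ((-(ε / 2) + (-(ε / 2)) ^ 2) / 2) - -(ε / 2) * ((1 - ε) * p) / 2
      = -(p * ε ^ 2 / 8) := by ring
  rw [e1] at hu
  rw [e2] at hl
  rw [two_mul]
  refine le_trans (measureReal_mono ?_ (measure_ne_top _ _)) ((measureReal_union_le _ _).trans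
    (add_le_add hu hl))
  intro z hz
  simp only [Set.mem_ofPred_eq, Set.mem_union] at hz ⊢
  rcases lt_abs.1 hz with h | h
  · left; nlinarith
  · right; nlinarith

/-- The fixed choice θ = 1/2 serves thresholds far above the mean: for the net argument and for the
input layer. -/
theorem chiSq_upper (p : ℕ) (τ : ℝ≥0) (R : ℝ) :
    (Measure.pi fun _ : Fin p => gaussianReal 0 τ).real
      {z | R * τ < ∑ i, z i ^ 2} ≤ Real.exp (p * (3 / 8) - R / 4) := by
  rcases eq_or_ne τ 0 with rfl | hτ
  · refine le_trans (le_of_eq ?_) (by positivity : (0 : ℝ) ≤ _)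
    rw [measureReal_eq_zero_iff, measure_eq_zero_iff_ae_notMem]
    filter_upwards [pi_gaussian_zero_sum_sq p] with z hz
    simp [hz]
  have hu := (chiSq_chernoff p (pos_iff_ne_zero.2 hτ) (θ := 1 / 2) (by norm_num) R).1
    (by norm_num)
  refine le_trans (measureReal_mono ?_ (measure_ne_top _ _)) (hu.trans (le_of_eq ?_))
  · intro z (hz : R * τ < ∑ i, z i ^ 2); exact hz.le
  · congr 1; ring

end PCNet

/-! ### Gaussian matrices applied to independent random vectors -/

namespace PCNet

open scoped NNReal ENNReal

/-- Fubini for the product law: freeze `Y`, bound each section, and integrate. -/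
theorem IndepFun.measureReal_le_of_forall {Ω α β : Type*} [MeasurableSpace Ω] [MeasurableSpace α]
    [MeasurableSpace β] {P : Measure Ω} [IsProbabilityMeasure P] {X : Ω → α} {Y : Ω → β}
    (hX : AEMeasurable X P) (hY : AEMeasurable Y P) (h : IndepFun X Y P) {B : Set (α × β)}
    (hB : MeasurableSet B) {c : ℝ} (hc : ∀ y, P.real {ω | (X ω, y) ∈ B} ≤ c) :
    P.real {ω | (X ω, Y ω) ∈ B} ≤ c := by
  have hP := Measure.isProbabilityMeasure_map (μ := P) hY
  have hP' := Measure.isProbabilityMeasure_map (μ := P) hX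
  have hne : Nonempty β := by
    by_contra hne
    rw [not_nonempty_iff] at hne
    have := hP.measure_univ
    rw [Set.univ_eq_empty_iff.2 hne, measure_empty] at this
    exact zero_ne_one this
  have hc0 : 0 ≤ c := measureReal_nonneg.trans (hc hne.some)
  have e : P {ω | (X ω, Y ω) ∈ B} = (P.map X).prod (P.map Y) B := by
    rw [← (indepFun_iff_map_prod_eq_prod_map_map hX hY).1 h,
      Measure.map_apply_of_aemeasurable (hX.prodMk hY) hB]
    rfl
  refine ENNReal.toReal_le_of_le_ofReal hc0 ?_
  rw [e, Measure.prod_apply_symm hB]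
  calc ∫⁻ y, (P.map X) ((fun x => (x, y)) ⁻¹' B) ∂(P.map Y)
      ≤ ∫⁻ _, ENNReal.ofReal c ∂(P.map Y) := by
        refine lintegral_mono fun y => ?_
        rw [Measure.map_apply_of_aemeasurable hX (measurable_prodMk_right hB)]
        exact ENNReal.le_ofReal_iff_toReal_le (measure_ne_top _ _) hc0 |>.2 (hc y)
    _ = ENNReal.ofReal c := by simp

theorem IsGaussianMatrix.aemeasurable {Ω : Type*} [MeasurableSpace Ω] {P : Measure Ω} {p q : ℕ}
    {s : ℝ≥0} {G : Ω → Matrix (Fin p) (Fin q) ℝ} (hG : IsGaussianMatrix P s G) :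
    AEMeasurable (fun ω (ij : Fin p × Fin q) => G ω ij.1 ij.2) P :=
  aemeasurable_pi_lambda _ fun _ => (hG.law _ _).aemeasurable

variable {Ω : Type*} [MeasurableSpace Ω] {P : Measure Ω} [IsProbabilityMeasure P] {p q : ℕ}
  {s : ℝ≥0} {G : Ω → Matrix (Fin p) (Fin q) ℝ}

theorem IsGaussianMatrix.deviation_const (hG : IsGaussianMatrix P s G) (v : Fin q → ℝ) {ε : ℝ}
    (h0 : 0 < ε) (h1 : ε ≤ 1) :
    P.real {ω | ε * (p * (s * ∑ i, v i ^ 2)) < |∑ i, (G ω *ᵥ v) i ^ 2 - p * (s * ∑ i, v i ^ 2)|}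
      ≤ 2 * Real.exp (-(p * ε ^ 2 / 8)) := by
  have h := hG.hasLaw_mulVec v
  have h2 := chiSq_deviation p (s * ∑ i, (v i ^ 2).toNNReal) h0 h1
  have e : ((s * ∑ i, (v i ^ 2).toNNReal : ℝ≥0) : ℝ) = s * ∑ i, v i ^ 2 := by
    push_cast
    simp [sq_nonneg]
  rw [e] at h2
  rw [measureReal_def, h.measure_eq
    (p := fun z => ε * (p * (s * ∑ i, v i ^ 2)) < |∑ i, z i ^ 2 - p * (s * ∑ i, v i ^ 2)|)
    (measurableSet_lt (by fun_prop) (by fun_prop))]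
  exact h2

theorem IsGaussianMatrix.upper_const (hG : IsGaussianMatrix P s G) (v : Fin q → ℝ) (R : ℝ) :
    P.real {ω | R * (s * ∑ i, v i ^ 2) < ∑ i, (G ω *ᵥ v) i ^ 2}
      ≤ Real.exp (p * (3 / 8) - R / 4) := by
  have h := hG.hasLaw_mulVec v
  have h2 := chiSq_upper p (s * ∑ i, (v i ^ 2).toNNReal) R
  have e : ((s * ∑ i, (v i ^ 2).toNNReal : ℝ≥0) : ℝ) = s * ∑ i, v i ^ 2 := by
    push_cast
    simp [sq_nonneg]
  rw [e] at h2
  rw [measureReal_def, h.measure_eq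
    (p := fun z => R * (s * ∑ i, v i ^ 2) < ∑ i, z i ^ 2)
    (measurableSet_lt (by fun_prop) (by fun_prop))]
  exact h2

/-- Measuring the deviation relative to ‖v‖² makes the bound for frozen v uniform in v, so it
survives randomization. -/
theorem IsGaussianMatrix.deviation (hG : IsGaussianMatrix P s G) {v : Ω → Fin q → ℝ}
    (hv : AEMeasurable v P) (hind : IndepFun (fun ω (ij : Fin p × Fin q) => G ω ij.1 ij.2) v P)
    {ε : ℝ} (h0 : 0 < ε) (h1 : ε ≤ 1) :
    P.real {ω | ε * (p * (s * ∑ i, v ω i ^ 2)) <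
        |∑ i, (G ω *ᵥ v ω) i ^ 2 - p * (s * ∑ i, v ω i ^ 2)|}
      ≤ 2 * Real.exp (-(p * ε ^ 2 / 8)) := by
  refine IndepFun.measureReal_le_of_forall hG.aemeasurable hv hind
    (B := {x | ε * (p * (s * ∑ i, x.2 i ^ 2)) <
        |∑ i, (∑ j, x.1 (i, j) * x.2 j) ^ 2 - p * (s * ∑ i, x.2 i ^ 2)|})
    (measurableSet_lt (by fun_prop) (by fun_prop)) fun y => ?_
  exact hG.deviation_const y h0 h1

theorem IsGaussianMatrix.upper (hG : IsGaussianMatrix P s G) {v : Ω → Fin q → ℝ}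
    (hv : AEMeasurable v P) (hind : IndepFun (fun ω (ij : Fin p × Fin q) => G ω ij.1 ij.2) v P)
    (R : ℝ) :
    P.real {ω | R * (s * ∑ i, v ω i ^ 2) < ∑ i, (G ω *ᵥ v ω) i ^ 2}
      ≤ Real.exp (p * (3 / 8) - R / 4) := by
  refine IndepFun.measureReal_le_of_forall hG.aemeasurable hv hind
    (B := {x | R * (s * ∑ i, x.2 i ^ 2) < ∑ i, (∑ j, x.1 (i, j) * x.2 j) ^ 2})
    (measurableSet_lt (by fun_prop) (by fun_prop)) fun y => ?_
  exact hG.upper_const y R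

/-! ### The operator norm of a Gaussian matrix -/

/-- A finite set of at most `5 ^ finrank` vectors that controls operator norms. -/
theorem exists_norming_finset (E : Type*) [NormedAddCommGroup E] [NormedSpace ℝ E]
    [FiniteDimensional ℝ E] :
    ∃ T : Finset E, T.card ≤ 5 ^ Module.finrank ℝ E ∧
      ∀ (F : Type) [NormedAddCommGroup F] [NormedSpace ℝ F] (A : E →L[ℝ] F) (C : ℝ), 0 ≤ C →
        (∀ u ∈ T, ‖A u‖ ≤ C * ‖u‖) → ‖A‖ ≤ 2 * C := by
  -- The finite set is a maximal 1-separated subset of the ball of radius 2: separation bounds its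
  -- size by volume, maximality makes it a 1-net.
  have hfin : ∀ S : Set E, S ⊆ Metric.closedBall 0 2 → Metric.IsSeparated ((1 : ℝ≥0) : ℝ≥0∞) S →
      ∀ t : Finset E, (t : Set E) ⊆ S → t.card ≤ 5 ^ Module.finrank ℝ E := by
    intro S hS hsep t ht
    refine Besicovitch.card_le_of_separated t (fun c hc => ?_) (fun c hc d hd hcd => ?_)
    · simpa using hS (ht hc)
    · have h1 : ((1 : ℝ≥0) : ℝ≥0∞) < edist c d := hsep (ht hc) (ht hd) hcd
      rw [edist_dist, dist_eq_norm] at h1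
      have h2 : ENNReal.ofReal 1 < ENNReal.ofReal ‖c - d‖ := by simpa using h1
      exact ((ENNReal.ofReal_lt_ofReal_iff_of_nonneg zero_le_one).1 h2).le
  have hpack : Metric.packingNumber 1 (Metric.closedBall (0 : E) 2)
      ≤ ((5 ^ Module.finrank ℝ E : ℕ) : ℕ∞) := by
    refine iSup_le fun S => iSup_le fun hS => iSup_le fun hsep => ?_
    have hSf : S.Finite := by
      by_contra hinf
      obtain ⟨t, ht, hcard⟩ := Set.Infinite.exists_subset_card_eq hinf (5 ^ Module.finrank ℝ E + 1)
      have := hfin S hS hsep t ht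
      omega
    rw [← hSf.coe_toFinset, Set.encard_coe_eq_coe_finsetCard]
    exact_mod_cast hfin S hS hsep hSf.toFinset (by simp)
  have hne : Metric.packingNumber 1 (Metric.closedBall (0 : E) 2) ≠ ⊤ :=
    ne_top_of_le_ne_top (ENat.natCast_ne_top _) hpack
  have hcov := Metric.isCover_maximalSeparatedSet hne
  have hMf : (Metric.maximalSeparatedSet 1 (Metric.closedBall (0 : E) 2)).Finite := by
    rw [← Set.encard_ne_top_iff, Metric.encard_maximalSeparatedSet hne]; exact hne
  refine ⟨hMf.toFinset, hfin _ Metric.maximalSeparatedSet_subset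
    Metric.isSeparated_maximalSeparatedSet _ (by simp), ?_⟩
  intro F _ _ A C hC hT
  -- A self-improving bound: a vector of norm 2 lies within 1 of a net point t, so its image is at
  -- most 2C + ‖A‖.
  have hb : ‖A‖ ≤ C + ‖A‖ / 2 := by
    refine A.opNorm_le_bound (by positivity) fun u => ?_
    rcases eq_or_ne u 0 with rfl | hu
    · simp
    have hu' : 0 < ‖u‖ := norm_pos_iff.2 hu
    set x : E := (2 / ‖u‖) • u with hx
    have hxn : ‖x‖ = 2 := by
      rw [hx, norm_smul, Real.norm_of_nonneg (by positivity)]; field_simp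
    obtain ⟨t, ht, hxt⟩ := hcov (show x ∈ Metric.closedBall (0 : E) 2 by simp [hxn])
    have hxt' : ‖x - t‖ ≤ 1 := by
      have h : edist x t ≤ ((1 : ℝ≥0) : ℝ≥0∞) := hxt
      rw [edist_dist, dist_eq_norm, ENNReal.coe_one] at h
      exact ENNReal.ofReal_le_one.1 h
    have htn : ‖t‖ ≤ 2 := by simpa using Metric.maximalSeparatedSet_subset ht
    have h1 : ‖A x‖ ≤ 2 * C + ‖A‖ := by
      calc ‖A x‖ = ‖A t + A (x - t)‖ := by rw [← map_add]; congr 2; abel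
        _ ≤ ‖A t‖ + ‖A (x - t)‖ := norm_add_le _ _
        _ ≤ C * 2 + ‖A‖ * 1 := by
          refine add_le_add ((hT t (by simpa using ht)).trans (by gcongr)) ?_
          exact (A.le_opNorm _).trans (by gcongr)
        _ = 2 * C + ‖A‖ := by ring
    have h2 : u = (‖u‖ / 2) • x := by
      rw [hx, smul_smul]
      have : ‖u‖ / 2 * (2 / ‖u‖) = 1 := by field_simp
      rw [this, one_smul]
    calc ‖A u‖ = ‖u‖ / 2 * ‖A x‖ := by
          conv_lhs => rw [h2]
          rw [map_smul, norm_smul, Real.norm_of_nonneg (by positivity)]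
      _ ≤ ‖u‖ / 2 * (2 * C + ‖A‖) := by gcongr
      _ = (C + ‖A‖ / 2) * ‖u‖ := by ring
  linarith

/-- Union bound over a net of 5 ^ q vectors, each failing at threshold 16p with probability at most
exp(3p/8 - 4p). As 5 ≤ e², this beats the cardinality when p = q; passing from net to operator norm
costs 2² in the square, whence 64. -/
theorem IsGaussianMatrix.operator_bound (hG : IsGaussianMatrix P s G) (hpq : p = q) :
    P.real {ω | ¬ ∀ u : Fin q → ℝ, ∑ i, (G ω *ᵥ u) i ^ 2 ≤ 64 * p * s * ∑ i, u i ^ 2}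
      ≤ Real.exp (-p) := by
  classical
  obtain ⟨T, hcard, hT⟩ := exists_norming_finset (EuclideanSpace ℝ (Fin q))
  rw [finrank_euclideanSpace_fin] at hcard
  have hsub : {ω | ¬ ∀ u : Fin q → ℝ, ∑ i, (G ω *ᵥ u) i ^ 2 ≤ 64 * p * s * ∑ i, u i ^ 2} ⊆
      ⋃ u ∈ T, {ω | (16 * p) * (s * ∑ i, u.ofLp i ^ 2) < ∑ i, (G ω *ᵥ u.ofLp) i ^ 2} := by
    intro ω hω
    by_contra hcon
    apply hω
    intro u
    simp only [Set.mem_iUnion, Set.mem_ofPred_eq, not_exists, not_lt] at hcon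
    have hA := hT (EuclideanSpace ℝ (Fin p)) (Matrix.toEuclideanLin (G ω)).toContinuousLinearMap
      (√(16 * p * s)) (by positivity) (fun v hv => by
        have h := hcon v hv
        rw [EuclideanSpace.norm_eq, EuclideanSpace.norm_eq, ← Real.sqrt_mul (by positivity)]
        apply Real.sqrt_le_sqrt
        simp only [Real.norm_eq_abs, sq_abs, LinearMap.coe_toContinuousLinearMap',
          Matrix.toLpLin_apply]
        linarith)
    have h2 := ((Matrix.toEuclideanLin (G ω)).toContinuousLinearMap.le_opNorm
      (WithLp.toLp 2 u)).trans (mul_le_mul_of_nonneg_right hA (norm_nonneg _))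
    have h3 := pow_le_pow_left₀ (norm_nonneg _) h2 2
    rw [mul_pow, mul_pow, Real.sq_sqrt (by positivity), EuclideanSpace.norm_sq_eq,
      EuclideanSpace.norm_sq_eq] at h3
    simp only [Real.norm_eq_abs, sq_abs, LinearMap.coe_toContinuousLinearMap',
      Matrix.toLpLin_apply] at h3
    linarith
  calc P.real _ ≤ P.real (⋃ u ∈ T, {ω | (16 * p) * (s * ∑ i, u.ofLp i ^ 2)
          < ∑ i, (G ω *ᵥ u.ofLp) i ^ 2}) := measureReal_mono hsub (measure_ne_top _ _)
    _ ≤ ∑ u ∈ T, P.real {ω | (16 * p) * (s * ∑ i, u.ofLp i ^ 2) < ∑ i, (G ω *ᵥ u.ofLp) i ^ 2} :=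
        measureReal_biUnion_finset_le _ _
    _ ≤ ∑ u ∈ T, Real.exp (p * (3 / 8) - 16 * p / 4) :=
        Finset.sum_le_sum fun u _ => hG.upper_const _ _
    _ ≤ 5 ^ q * Real.exp (p * (3 / 8) - 16 * p / 4) := by
        rw [Finset.sum_const, nsmul_eq_mul]
        gcongr
        exact_mod_cast hcard
    _ ≤ Real.exp 2 ^ p * Real.exp (p * (3 / 8) - 16 * p / 4) := by
        rw [hpq]
        gcongr
        have := Real.quadratic_le_exp_of_nonneg (x := 2) (by norm_num)
        norm_num at this
        linarith
    _ ≤ Real.exp (-p) := by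
        rw [← Real.exp_nat_mul, ← Real.exp_add]
        gcongr
        have : (0 : ℝ) ≤ p := by positivity
        linarith

end PCNet

namespace PCNet

open scoped NNReal ENNReal

/-! ### Algebra of products of weights -/

section Products

variable {n : ℕ → ℕ}

theorem weightProd_succ (W : Weights n) {i j : ℕ} (h : i ≤ j) :
    weightProd W (j + 1) i = W j * weightProd W j i := by
  simp [weightProd, h]

theorem weightProd_self (W : Weights n) (j : ℕ) : weightProd W j j = 1 := by
  cases j <;> ext a b <;> simp [weightProd, Matrix.one_apply, Fin.ext_iff]

theorem weightProd_left (W : Weights n) {i j : ℕ} (h : i < j) :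
    weightProd W j i = weightProd W j (i + 1) * W i := by
  induction j, h using Nat.le_induction with
  | base => rw [weightProd_succ W le_rfl, weightProd_self, weightProd_self, Matrix.one_mul,
      Matrix.mul_one]
  | succ j hj ih =>
    rw [weightProd_succ W (by omega), ih, weightProd_succ W (by omega : i + 1 ≤ j),
      Matrix.mul_assoc]

theorem weightProd_congr {W W' : Weights n} {i j : ℕ} (hij : i ≤ j)
    (h : ∀ l, i ≤ l → l < j → W l = W' l) : weightProd W j i = weightProd W' j i := by
  induction j, hij using Nat.le_induction with
  | base => rw [weightProd_self, weightProd_self]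
  | succ j hj ih =>
    rw [weightProd_succ W hj, weightProd_succ W' hj, h j hj (by omega),
      ih fun l h1 h2 => h l h1 (by omega)]

theorem measurable_weightProd {κ : Type*} [MeasurableSpace κ] {Z : κ → Weights n}
    (hZ : ∀ l i j, Measurable fun z => Z z l i j) {i j : ℕ} (hij : i ≤ j) (a : Fin (n j))
    (b : Fin (n i)) : Measurable fun z => weightProd (Z z) j i a b := by
  induction j, hij using Nat.le_induction with
  | base => simp only [weightProd_self]; exact measurable_const
  | succ j hj ih =>
    simp only [weightProd_succ _ hj, Matrix.mul_apply]
    exact Finset.measurable_sum _ fun c _ => (hZ j a c).mul (ih c)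

end Products

/-! ### Independence between the layers -/

section Independence

variable {Ω : Type*} [MeasurableSpace Ω] {P : Measure Ω} {n : ℕ → ℕ}

/-- All entries of the weights of the connections `0, …, H` are independent, and those
of the connection `l` are centred Gaussian of variance `s l`. -/
structure IsGaussianNet (P : Measure Ω) (H : ℕ) (s : ℕ → ℝ≥0) (W : Ω → Weights n) : Prop where
  law : ∀ l ≤ H, ∀ i j, HasLaw (fun ω => W ω l i j) (gaussianReal 0 (s l)) P
  indep : iIndepFun (fun (p : Σ l : Fin (H + 1), Fin (n ((l : ℕ) + 1)) × Fin (n (l : ℕ))) (ω : Ω) =>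
    W ω (p.1 : ℕ) p.2.1 p.2.2) P

theorem IsGaussianNet.layer {H : ℕ} {s : ℕ → ℝ≥0} {W : Ω → Weights n}
    (hW : IsGaussianNet P H s W) {l : ℕ} (hl : l ≤ H) :
    IsGaussianMatrix P (s l) fun ω => W ω l := by
  let g : Fin (n (l + 1)) × Fin (n l) →
      Σ l : Fin (H + 1), Fin (n ((l : ℕ) + 1)) × Fin (n (l : ℕ)) := fun ij => ⟨⟨l, by omega⟩, ij⟩
  have hg : Function.Injective g := fun a b hab => by simpa [g] using hab
  exact ⟨hW.law l hl, hW.indep.precomp hg⟩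

/-- A layer is independent of every vector that is computed from other layers. -/
theorem IsGaussianNet.indep_layer {H : ℕ} {s : ℕ → ℝ≥0} {W : Ω → Weights n}
    (hW : IsGaussianNet P H s W) {l : ℕ} (hl : l ≤ H) {T : Set ℕ} (hT : l ∉ T) {q : ℕ}
    {h : Weights n → Fin q → ℝ}
    (hdep : ∀ W W' : Weights n, (∀ k ≤ H, k ∈ T → W k = W' k) → h W = h W')
    (hmeas : ∀ (κ : Type) [MeasurableSpace κ] (Z : κ → Weights n),
      (∀ l i j, Measurable fun z => Z z l i j) → Measurable fun z => h (Z z)) :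
    AEMeasurable (fun ω => h (W ω)) P ∧
    IndepFun (fun ω (ij : Fin (n (l + 1)) × Fin (n l)) => W ω l ij.1 ij.2) (fun ω => h (W ω)) P := by
  classical
  set S₁ : Finset (Σ l : Fin (H + 1), Fin (n ((l : ℕ) + 1)) × Fin (n (l : ℕ))) :=
    Finset.univ.filter fun p => (p.1 : ℕ) = l with hS₁
  set S₂ : Finset (Σ l : Fin (H + 1), Fin (n ((l : ℕ) + 1)) × Fin (n (l : ℕ))) :=
    Finset.univ.filter fun p => (p.1 : ℕ) ∈ T with hS₂
  have hm : ∀ p : (Σ l : Fin (H + 1), Fin (n ((l : ℕ) + 1)) × Fin (n (l : ℕ))),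
      AEMeasurable (fun ω => W ω (p.1 : ℕ) p.2.1 p.2.2) P :=
    fun p => (hW.law _ (by omega) _ _).aemeasurable
  have hdisj : Disjoint S₁ S₂ := by
    rw [Finset.disjoint_left]
    intro p hp hp'
    simp only [hS₁, hS₂, Finset.mem_filter, Finset.mem_univ, true_and] at hp hp'
    exact hT (hp ▸ hp')
  have hind := hW.indep.indepFun_finset₀ S₁ S₂ hdisj hm
  let φ : (S₁ → ℝ) → (Fin (n (l + 1)) × Fin (n l) → ℝ) :=
    fun z ij => z ⟨⟨⟨l, by omega⟩, ij⟩, by simp [hS₁]⟩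
  -- Weights rebuilt from the entries with layer in `T`, and zero elsewhere. By `hdep` the function
  -- `h` cannot tell them from the true ones, so h(W) is a measurable function of entries
  -- independent of layer l.
  let ρ : (S₂ → ℝ) → Weights n := fun z k i j =>
    if hk : k < H + 1 ∧ k ∈ T then z ⟨⟨⟨k, hk.1⟩, (i, j)⟩, by simp [hS₂, hk.2]⟩ else 0
  have hφ : Measurable φ := measurable_pi_lambda _ fun ij => measurable_pi_apply _
  have hρ : Measurable fun z => h (ρ z) := by
    refine hmeas _ ρ fun k i j => ?_
    by_cases hk : k < H + 1 ∧ k ∈ T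
    · simp only [ρ, hk, and_self, dite_true]
      exact measurable_pi_apply _
    · simp only [ρ, hk, dite_false]
      exact measurable_const
  have e : (fun ω => h (W ω)) = (fun z => h (ρ z)) ∘ fun ω (p : S₂) =>
      W ω (p.1.1 : ℕ) p.1.2.1 p.1.2.2 := by
    ext1 ω
    refine hdep _ _ fun k hk hkT => ?_
    ext i j
    have hk' : k < H + 1 ∧ k ∈ T := ⟨by omega, hkT⟩
    simp only [ρ, hk', and_self, dite_true]
  rw [e]
  exact ⟨hρ.comp_aemeasurable (aemeasurable_pi_lambda _ fun p => hm _), hind.comp hφ hρ⟩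

theorem IndepFun.comp_swap {p q : ℕ} {β : Type*} [MeasurableSpace β]
    {G : Ω → Matrix (Fin p) (Fin q) ℝ} {v : Ω → β}
    (h : IndepFun (fun ω (ij : Fin p × Fin q) => G ω ij.1 ij.2) v P) :
    IndepFun (fun ω (ij : Fin q × Fin p) => (G ω)ᵀ ij.1 ij.2) v P :=
  h.comp (φ := fun (z : Fin p × Fin q → ℝ) (ij : Fin q × Fin p) => z ij.swap) (ψ := id)
    (measurable_pi_lambda _ fun _ => measurable_pi_apply _) measurable_id

/-- Backward pass: the layer `l` is independent of what comes down from above. -/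
theorem IsGaussianNet.indep_backward {H : ℕ} {s : ℕ → ℝ≥0} {W : Ω → Weights n}
    (hW : IsGaussianNet P H s W) {l : ℕ} (hl : l ≤ H) (u : Fin (n (H + 1)) → ℝ) :
    AEMeasurable (fun ω => (weightProd (W ω) (H + 1) (l + 1))ᵀ *ᵥ u) P ∧
    IndepFun (fun ω (ij : Fin (n (l + 1)) × Fin (n l)) => W ω l ij.1 ij.2)
      (fun ω => (weightProd (W ω) (H + 1) (l + 1))ᵀ *ᵥ u) P := by
  refine hW.indep_layer hl (T := {k | l < k}) (by simp)
    (h := fun W => (weightProd W (H + 1) (l + 1))ᵀ *ᵥ u) (fun W W' h => ?_) (fun κ _ Z hZ => ?_)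
  · rw [weightProd_congr (by omega) fun k h1 h2 => h k (by omega) h1]
  · refine measurable_pi_lambda _ fun i => ?_
    simp only [Matrix.mulVec, dotProduct, Matrix.transpose_apply]
    exact Finset.measurable_sum _ fun c _ =>
      (measurable_weightProd hZ (by omega) _ _).mul_const _

/-- Forward pass: the layer `l` is independent of what comes up from below. -/
theorem IsGaussianNet.indep_forward {H : ℕ} {s : ℕ → ℝ≥0} {W : Ω → Weights n}
    (hW : IsGaussianNet P H s W) {l : ℕ} (hl : l ≤ H) (u : Fin (n 0) → ℝ) :
    AEMeasurable (fun ω => weightProd (W ω) l 0 *ᵥ u) P ∧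
    IndepFun (fun ω (ij : Fin (n (l + 1)) × Fin (n l)) => W ω l ij.1 ij.2)
      (fun ω => weightProd (W ω) l 0 *ᵥ u) P := by
  refine hW.indep_layer hl (T := {k | k < l}) (by simp)
    (h := fun W => weightProd W l 0 *ᵥ u) (fun W W' h => ?_) (fun κ _ Z hZ => ?_)
  · rw [weightProd_congr (by omega) fun k h1 h2 => h k (by omega) h2]
  · refine measurable_pi_lambda _ fun i => ?_
    simp only [Matrix.mulVec, dotProduct]
    exact Finset.measurable_sum _ fun c _ =>
      (measurable_weightProd hZ (by omega) _ _).mul_const _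

end Independence

/-! ### Almost sure asymptotics in the width -/

section AlmostSure

variable {Ω : Type*} [MeasurableSpace Ω] {P : Measure Ω} [IsProbabilityMeasure P]

/-- The first Borel–Cantelli lemma; it needs no independence between different M, hence no
assumption on the joint law. -/
theorem ae_eventually_not_of_measureReal_le {bad : ℕ → Ω → Prop} {g : ℕ → ℝ} (hg : Summable g)
    (h : ∀ M, P.real {ω | bad M ω} ≤ g M) : ∀ᵐ ω ∂P, ∀ᶠ M in atTop, ¬ bad M ω := by
  refine ae_eventually_notMem (s := fun M => {ω | bad M ω}) ?_
  have h0 : ∀ M, 0 ≤ g M := fun M => measureReal_nonneg.trans (h M)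
  refine ne_top_of_le_ne_top (hg.tsum_ofReal_ne_top) (ENNReal.tsum_le_tsum fun M => ?_)
  exact (ENNReal.le_ofReal_iff_toReal_le (measure_ne_top _ _) (h0 M)).2 (h M)

theorem summable_exp_neg_mul {c : ℝ} (hc : 0 < c) : Summable fun M : ℕ => Real.exp (-(M * c)) := by
  have := Real.summable_exp_nat_mul_iff.2 (neg_lt_zero.2 hc)
  simpa using this

/-- `a` is asymptotically equal to `b`, uniformly over the index. -/
def RelClose {ι : ℕ → Type} (a b : ∀ M, ι M → ℝ) : Prop :=
  ∀ ε > 0, ∀ᶠ M in atTop, ∀ i, |a M i - b M i| ≤ ε * b M i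

theorem RelClose.trans {ι : ℕ → Type} {a b c : ∀ M, ι M → ℝ} {t u : ℕ → ℝ} (ht : ∀ M, 0 ≤ t M)
    (h1 : RelClose a fun M i => t M * b M i) (h2 : RelClose b fun M i => u M * c M i) :
    RelClose a fun M i => t M * u M * c M i := by
  intro ε hε
  -- Two relative errors δ combine to (1 + δ)² - 1 = δ(2 + δ) ≤ 3δ ≤ ε.
  have hδ : 0 < min ε 1 / 3 := by positivity
  filter_upwards [h1 _ hδ, h2 _ hδ] with M h1 h2 i
  have h1 := h1 i
  have h2 := h2 i
  set δ := min ε 1 / 3 with hδd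
  have hδ1 : δ ≤ 1 / 3 := by rw [hδd]; linarith [min_le_right ε 1]
  have hδ2 : 3 * δ ≤ ε := by rw [hδd]; linarith [min_le_left ε 1]
  -- Closeness itself forces the comparison quantity to be nonnegative.
  have hb0 : 0 ≤ u M * c M i :=
    nonneg_of_mul_nonneg_right ((abs_nonneg _).trans h2) hδ
  have hb1 : b M i ≤ (1 + δ) * (u M * c M i) := by linarith [(abs_le.1 h2).2]
  have h3 : |t M * b M i - t M * (u M * c M i)| ≤ t M * (δ * (u M * c M i)) := by
    rw [← mul_sub, abs_mul, abs_of_nonneg (ht M)]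
    exact mul_le_mul_of_nonneg_left h2 (ht M)
  have h4 : t M * b M i ≤ t M * ((1 + δ) * (u M * c M i)) :=
    mul_le_mul_of_nonneg_left hb1 (ht M)
  have h5 : 0 ≤ t M * (u M * c M i) := mul_nonneg (ht M) hb0
  calc |a M i - t M * u M * c M i|
      = |(a M i - t M * b M i) + (t M * b M i - t M * (u M * c M i))| := by congr 1; ring
    _ ≤ δ * (t M * b M i) + t M * (δ * (u M * c M i)) := (abs_add_le _ _).trans (add_le_add h1 h3)
    _ ≤ δ * (t M * ((1 + δ) * (u M * c M i))) + t M * (δ * (u M * c M i)) := by gcongr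
    _ = (δ * (2 + δ)) * (t M * (u M * c M i)) := by ring
    _ ≤ ε * (t M * (u M * c M i)) := by gcongr; nlinarith
    _ = ε * (t M * u M * c M i) := by ring

/-- Sum of the squares of the entries. -/
def sqSum {p : ℕ} (v : Fin p → ℝ) : ℝ := ∑ i, v i ^ 2

/-- Gaussian matrices with `M` rows almost surely act asymptotically as multiples of isometries
on boundedly many independent vectors. -/
theorem ae_relClose_gaussian {p q k : ℕ → ℕ} {K : ℕ} (hp : ∀ M, p M = M) (hk : ∀ M, k M ≤ K)
    {s : ℕ → ℝ≥0} {G : ∀ M, Ω → Matrix (Fin (p M)) (Fin (q M)) ℝ}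
    (hG : ∀ M, IsGaussianMatrix P (s M) (G M))
    {v : ∀ M, Fin (k M) × Fin (k M) → Ω → Fin (q M) → ℝ}
    (hv : ∀ M i, AEMeasurable (v M i) P ∧
      IndepFun (fun ω (ij : Fin (p M) × Fin (q M)) => G M ω ij.1 ij.2) (v M i) P) :
    ∀ᵐ ω ∂P, RelClose (ι := fun M => Fin (k M) × Fin (k M)) (fun M i => sqSum (G M ω *ᵥ v M i ω))
      fun M i => (M * s M) * sqSum (v M i ω) := by
  -- Only the countably many tolerances 1/(r+1) are treated, so that one null set serves every ε.
  have key : ∀ r : ℕ, ∀ᵐ ω ∂P, ∀ᶠ M in atTop, ∀ i, |sqSum (G M ω *ᵥ v M i ω)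
      - (M * s M) * sqSum (v M i ω)| ≤ (1 / ((r : ℝ) + 1)) * ((M * s M) * sqSum (v M i ω)) := by
    intro r
    set ε : ℝ := 1 / ((r : ℝ) + 1) with hε
    have h0 : 0 < ε := by positivity
    have h1 : ε ≤ 1 := by
      rw [hε, div_le_one (by positivity)]
      have : (0 : ℝ) ≤ r := by positivity
      linarith
    have := ae_eventually_not_of_measureReal_le (P := P)
      (bad := fun M ω => ∃ i, ε * ((M * s M) * sqSum (v M i ω)) <
        |sqSum (G M ω *ᵥ v M i ω) - (M * s M) * sqSum (v M i ω)|)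
      (g := fun M => ((K : ℝ) * K) * (2 * Real.exp (-(M * (ε ^ 2 / 8)))))
      (((summable_exp_neg_mul (by positivity)).mul_left _).mul_left _) (fun M => ?_)
    · filter_upwards [this] with ω hω
      filter_upwards [hω] with M hM i
      simp only [not_exists, not_lt] at hM
      exact hM i
    · rw [Set.ofPred_exists]
      refine (measureReal_iUnion_fintype_le _).trans ?_
      calc ∑ i, P.real {ω | ε * ((M * s M) * sqSum (v M i ω)) <
              |sqSum (G M ω *ᵥ v M i ω) - (M * s M) * sqSum (v M i ω)|}
          ≤ ∑ _i : Fin (k M) × Fin (k M), 2 * Real.exp (-(M * (ε ^ 2 / 8))) := by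
            refine Finset.sum_le_sum fun i _ => ?_
            have h := (hG M).deviation (hv M i).1 (hv M i).2 h0 h1
            simp only [hp M, mul_div_assoc] at h
            simpa only [sqSum, mul_assoc] using h
        _ ≤ _ := by
            rw [Finset.sum_const, Finset.card_univ, Fintype.card_prod, Fintype.card_fin,
              nsmul_eq_mul]
            push_cast
            have := hk M
            gcongr
  filter_upwards [ae_all_iff.2 key] with ω hω ε hε
  obtain ⟨r, hr⟩ := exists_nat_one_div_lt hε
  filter_upwards [hω r] with M hM i
  refine (hM i).trans (mul_le_mul_of_nonneg_right hr.le ?_)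
  exact mul_nonneg (by positivity) (Finset.sum_nonneg fun _ _ => sq_nonneg _)

end AlmostSure

end PCNet

namespace PCNet

open scoped NNReal ENNReal

/-! ### Frobenius norms and polarization -/

section Frobenius

theorem frobenius_sq {p q : ℕ} (A : Matrix (Fin p) (Fin q) ℝ) :
    ‖A‖ ^ 2 = ∑ i, ∑ j, A i j ^ 2 := by
  rw [Matrix.frobenius_norm_def, ← Real.sqrt_eq_rpow, Real.sq_sqrt (by positivity)]
  simp

theorem frobenius_sq_eq_sum_sqSum {p q : ℕ} (A : Matrix (Fin p) (Fin q) ℝ) :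
    ‖A‖ ^ 2 = ∑ j, sqSum (A.col j) := by
  rw [frobenius_sq, Finset.sum_comm]; rfl

theorem frobenius_sq_mul {p q r : ℕ} (A : Matrix (Fin p) (Fin q) ℝ)
    (B : Matrix (Fin q) (Fin r) ℝ) : ‖A * B‖ ^ 2 = ∑ j, sqSum (A *ᵥ B.col j) := by
  rw [frobenius_sq_eq_sum_sqSum]; rfl

/-- Sum of two standard basis vectors. -/
def pairVec (k : ℕ) (i : Fin k × Fin k) : Fin k → ℝ := Pi.single i.1 1 + Pi.single i.2 1

theorem sqSum_nonneg {p : ℕ} (v : Fin p → ℝ) : 0 ≤ sqSum v :=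
  Finset.sum_nonneg fun _ _ => sq_nonneg _

theorem sqSum_pairVec (k : ℕ) (i j : Fin k) :
    sqSum (pairVec k (i, j)) = if i = j then 4 else 2 := by
  have h : ∀ a, pairVec k (i, j) a ^ 2 = (if a = i then 1 else 0) + (if a = j then 1 else 0)
      + 2 * (if a = i then (if i = j then 1 else 0) else 0) := by
    intro a
    simp only [pairVec, Pi.add_apply, Pi.single_apply]
    by_cases h1 : a = i
    · subst h1
      by_cases h2 : a = j
      · simp [h2]; norm_num
      · simp [h2]
    · by_cases h2 : a = j
      · subst h2
        simp [h1]
      · simp [h1, h2]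
  simp only [sqSum, h, Finset.sum_add_distrib, ← Finset.mul_sum, Finset.sum_ite_eq',
    Finset.mem_univ, if_true]
  split_ifs <;> norm_num

/-- Polarization: a matrix that is nearly a multiple of an isometry on the sums of pairs
of basis vectors is so on all vectors. -/
theorem near_isometry_of_pairs {p k : ℕ} (B : Matrix (Fin p) (Fin k) ℝ) {α η : ℝ}
    (h : ∀ i, |sqSum (B *ᵥ pairVec k i) - α * sqSum (pairVec k i)|
      ≤ η * (α * sqSum (pairVec k i))) (u : Fin k → ℝ) :
    |sqSum (B *ᵥ u) - α * sqSum u| ≤ 2 * (η * α) * k * sqSum u := by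
  -- The Gram matrix of the columns: showing that it is entrywise close to α times the identity
  -- suffices.
  set g : Fin k → Fin k → ℝ := fun i j => ∑ a, B a i * B a j with hg
  have hB : ∀ u : Fin k → ℝ, sqSum (B *ᵥ u) = ∑ i, ∑ j, u i * u j * g i j := by
    intro u
    have h1 : ∀ a, (∑ i, B a i * u i) ^ 2 = ∑ i, ∑ j, u i * u j * (B a i * B a j) := by
      intro a
      rw [sq, Finset.sum_mul_sum]
      exact Finset.sum_congr rfl fun i _ => Finset.sum_congr rfl fun j _ => by ring
    simp only [sqSum, Matrix.mulVec, dotProduct, h1, hg, Finset.mul_sum]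
    rw [Finset.sum_comm]
    exact Finset.sum_congr rfl fun i _ => Finset.sum_comm
  have hsymm : ∀ i j, g i j = g j i := fun i j => by simp only [hg, mul_comm]
  have hpair : ∀ i j, sqSum (B *ᵥ pairVec k (i, j)) = g i i + 2 * g i j + g j j := by
    intro i j
    have e : B *ᵥ pairVec k (i, j) = fun a => B a i + B a j := by
      ext a; simp [pairVec, Matrix.mulVec_add]
    rw [e]
    simp only [sqSum, hg, Finset.mul_sum, ← Finset.sum_add_distrib]
    exact Finset.sum_congr rfl fun a _ => by ring
  have hd : ∀ i, |g i i - α| ≤ η * α := by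
    intro i
    have := h (i, i)
    rw [hpair, sqSum_pairVec, if_pos rfl] at this
    rw [abs_le] at this ⊢
    constructor <;> linarith [this.1, this.2]
  -- Off the diagonal, 2 g i j is the value on a pair minus two diagonal entries, with errors 2ηα +
  -- ηα + ηα.
  have hent : ∀ i j, |g i j - α * (if i = j then 1 else 0)| ≤ 2 * (η * α) := by
    intro i j
    have h0 : 0 ≤ η * α := (abs_nonneg _).trans (hd i)
    by_cases hij : i = j
    · subst hij
      simp only [if_true, mul_one]
      linarith [hd i]
    · have := h (i, j)
      rw [hpair, sqSum_pairVec, if_neg hij] at this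
      have h1 := hd i
      have h2 := hd j
      simp only [hij, if_false, mul_zero, sub_zero]
      rw [abs_le] at *
      constructor <;> linarith [this.1, this.2, h1.1, h1.2, h2.1, h2.2]
  have e : sqSum (B *ᵥ u) - α * sqSum u
      = ∑ i, ∑ j, u i * u j * (g i j - α * (if i = j then 1 else 0)) := by
    simp only [mul_sub, Finset.sum_sub_distrib, ← hB]
    congr 1
    simp only [mul_ite, mul_one, mul_zero, Finset.sum_ite_eq, Finset.mem_univ, if_true, sqSum,
      Finset.mul_sum]
    exact Finset.sum_congr rfl fun i _ => by ring
  rw [e]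
  rcases Nat.eq_zero_or_pos k with rfl | hk
  · simp
  have h0 : 0 ≤ η * α := (abs_nonneg _).trans (hd ⟨0, hk⟩)
  calc |∑ i, ∑ j, u i * u j * (g i j - α * (if i = j then 1 else 0))|
      ≤ ∑ i, ∑ j, |u i| * |u j| * (2 * (η * α)) := by
        refine (Finset.abs_sum_le_sum_abs _ _).trans (Finset.sum_le_sum fun i _ => ?_)
        refine (Finset.abs_sum_le_sum_abs _ _).trans (Finset.sum_le_sum fun j _ => ?_)
        rw [abs_mul, abs_mul]
        exact mul_le_mul_of_nonneg_left (hent i j) (by positivity)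
    _ = 2 * (η * α) * (∑ i, |u i|) ^ 2 := by
        rw [sq, Finset.sum_mul_sum, Finset.mul_sum]
        refine Finset.sum_congr rfl fun i _ => ?_
        rw [Finset.mul_sum]
        exact Finset.sum_congr rfl fun j _ => by ring
    _ ≤ 2 * (η * α) * (k * sqSum u) := by
        gcongr
        have := sq_sum_le_card_mul_sum_sq (s := Finset.univ) (f := fun i => |u i|)
        simpa [sqSum] using this
    _ = _ := by ring

/-- Near isometries for the Frobenius norm, from asymptotic closeness on pairs. -/
theorem RelClose.frobenius {p k : ℕ → ℕ} {K : ℕ} (hk : ∀ M, k M ≤ K)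
    {B : ∀ M, Matrix (Fin (p M)) (Fin (k M)) ℝ} {α : ℕ → ℝ} (hα : ∀ M, 0 ≤ α M)
    (h : RelClose (ι := fun M => Fin (k M) × Fin (k M))
      (fun M i => sqSum (B M *ᵥ pairVec (k M) i)) fun M i => α M * sqSum (pairVec (k M) i)) :
    ∀ᶠ M in atTop, ∀ (N : ℕ) (Y : Matrix (Fin (k M)) (Fin N) ℝ),
      1 / 2 * α M * ‖Y‖ ^ 2 ≤ ‖B M * Y‖ ^ 2 ∧ ‖B M * Y‖ ^ 2 ≤ 2 * α M * ‖Y‖ ^ 2 := by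
  -- Polarization loses a factor 2k ≤ 2(K + 1), so this tolerance leaves relative error at most 1/2.
  filter_upwards [h (1 / (4 * (K + 1))) (by positivity)] with M hM N Y
  have hu : ∀ u : Fin (k M) → ℝ, |sqSum (B M *ᵥ u) - α M * sqSum u| ≤ 1 / 2 * α M * sqSum u := by
    intro u
    refine (near_isometry_of_pairs (B M) hM u).trans ?_
    refine mul_le_mul_of_nonneg_right ?_ (sqSum_nonneg u)
    have h1 : (k M : ℝ) ≤ K + 1 := by
      have : (k M : ℝ) ≤ K := by exact_mod_cast hk M
      linarith
    calc 2 * (1 / (4 * ((K : ℝ) + 1)) * α M) * (k M)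
        ≤ 2 * (1 / (4 * ((K : ℝ) + 1)) * α M) * (K + 1) := by
          have := hα M
          gcongr
      _ = 1 / 2 * α M := by field_simp; norm_num
  rw [frobenius_sq_mul, frobenius_sq_eq_sum_sqSum Y, Finset.mul_sum, Finset.mul_sum]
  constructor
  · refine Finset.sum_le_sum fun j _ => ?_
    have := abs_le.1 (hu (Y.col j))
    linarith [this.1]
  · refine Finset.sum_le_sum fun j _ => ?_
    have := abs_le.1 (hu (Y.col j))
    have h2 : 0 ≤ α M * sqSum (Y.col j) := mul_nonneg (hα M) (sqSum_nonneg _)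
    linarith [this.2]

end Frobenius

/-! ### Concentration for the network, layer by layer -/

section Network

variable {Ω : Type*} [MeasurableSpace Ω] {P : Measure Ω} [IsProbabilityMeasure P] {H d m : ℕ}
  {s : ℕ → ℕ → ℝ≥0} {W : ∀ M, Ω → Weights (width H d m M)}

theorem width_hidden {M l : ℕ} (h1 : 1 ≤ l) (h2 : l ≤ H) : width H d m M l = M := by
  simp [width, h2]; omega

/-- Downward induction: each transposed layer has M rows as long as l ≥ 1, and is independent of the
vector arriving from above. -/
theorem ae_relClose_backward (hW : ∀ M, IsGaussianNet P H (s M) (W M)) {l : ℕ}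
    (hl : l ≤ H + 1) (hl1 : 1 ≤ l) :
    ∀ᵐ ω ∂P, RelClose
      (ι := fun M => Fin (width H d m M (H + 1)) × Fin (width H d m M (H + 1)))
      (fun M i => sqSum ((weightProd (W M ω) (H + 1) l)ᵀ *ᵥ pairVec _ i))
      fun M i => (∏ k ∈ Finset.Ico l (H + 1), (M * s M k : ℝ)) * sqSum (pairVec _ i) := by
  induction hl using Nat.decreasingInduction with
  | self =>
    refine ae_of_all _ fun ω ε hε => Eventually.of_forall fun M i => ?_
    simp only [weightProd_self, Matrix.transpose_one, Matrix.one_mulVec, Finset.Ico_self,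
      Finset.prod_empty, one_mul, sub_self, abs_zero]
    exact mul_nonneg hε.le (sqSum_nonneg _)
  | of_succ l hl ih =>
    have h := ae_relClose_gaussian (P := P) (K := m)
      (p := fun M => width H d m M l) (q := fun M => width H d m M (l + 1))
      (k := fun M => width H d m M (H + 1)) (s := fun M => s M l)
      (G := fun M ω => (W M ω l)ᵀ)
      (v := fun M i ω => (weightProd (W M ω) (H + 1) (l + 1))ᵀ *ᵥ pairVec _ i)
      (fun M => width_hidden hl1 (by omega)) (fun M => (width_last H d m M).le)
      (fun M => ((hW M).layer (by omega)).transpose)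
      (fun M i => ⟨((hW M).indep_backward (by omega) _).1,
        IndepFun.comp_swap ((hW M).indep_backward (by omega) _).2⟩)
    filter_upwards [h, ih (by omega)] with ω h1 h2
    have h3 := h1.trans (fun M => by positivity) h2
    simp only [Matrix.mulVec_mulVec, ← Matrix.transpose_mul, ← weightProd_left _ hl] at h3
    simpa only [Finset.prod_eq_prod_Ico_succ_bot hl] using h3

/-- Upward induction; stopping at l ≤ H ensures that every layer used has M rows. -/
theorem ae_relClose_forward (hW : ∀ M, IsGaussianNet P H (s M) (W M)) {l : ℕ} (hl : l ≤ H) :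
    ∀ᵐ ω ∂P, RelClose (ι := fun M => Fin (width H d m M 0) × Fin (width H d m M 0))
      (fun M i => sqSum (weightProd (W M ω) l 0 *ᵥ pairVec _ i))
      fun M i => (∏ k ∈ Finset.range l, (M * s M k : ℝ)) * sqSum (pairVec _ i) := by
  induction l with
  | zero =>
    refine ae_of_all _ fun ω ε hε => Eventually.of_forall fun M i => ?_
    simp only [weightProd_self, Matrix.one_mulVec, Finset.range_zero,
      Finset.prod_empty, one_mul, sub_self, abs_zero]
    exact mul_nonneg hε.le (sqSum_nonneg _)
  | succ l ih =>
    have h := ae_relClose_gaussian (P := P) (K := d)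
      (p := fun M => width H d m M (l + 1)) (q := fun M => width H d m M l)
      (k := fun M => width H d m M 0) (s := fun M => s M l) (G := fun M ω => W M ω l)
      (v := fun M i ω => weightProd (W M ω) l 0 *ᵥ pairVec _ i)
      (fun M => width_hidden (by omega) hl) (fun M => (width_zero H d m M).le)
      (fun M => (hW M).layer (by omega)) (fun M i => (hW M).indep_forward (by omega) _)
    filter_upwards [h, ih (by omega)] with ω h1 h2
    have h3 := h1.trans (fun M => by positivity) h2
    simp only [Matrix.mulVec_mulVec, ← weightProd_succ _ (Nat.zero_le l)] at h3
    simp only [Finset.prod_range_succ]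
    convert h3 using 4
    ring

/-- Uniformity in `Y` matters: it will be applied to the state deviation v_l - u_l, which is not
independent of W_l. -/
theorem ae_operator_bound (hW : ∀ M, IsGaussianNet P H (s M) (W M)) {l : ℕ} (h1 : 1 ≤ l)
    (hl : l < H) : ∀ᵐ ω ∂P, ∀ᶠ M : ℕ in atTop, ∀ (N : ℕ)
      (Y : Matrix (Fin (width H d m M l)) (Fin N) ℝ),
      ‖W M ω l * Y‖ ^ 2 ≤ 64 * M * s M l * ‖Y‖ ^ 2 := by
  have hs : Summable fun M : ℕ => Real.exp (-M) := by
    simpa using summable_exp_neg_mul zero_lt_one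
  have := ae_eventually_not_of_measureReal_le (P := P)
    (bad := fun M ω => ¬ ∀ u : Fin (width H d m M l) → ℝ,
      ∑ i, (W M ω l *ᵥ u) i ^ 2 ≤ 64 * M * s M l * ∑ i, u i ^ 2) hs fun M => by
    have h := ((hW M).layer hl.le).operator_bound
      ((width_hidden (by omega) hl).trans (width_hidden h1 hl.le).symm)
    have e : ((width H d m M (l + 1) : ℕ) : ℝ) = M := by rw [width_hidden (by omega) hl]
    rwa [e] at h
  filter_upwards [this] with ω hω
  filter_upwards [hω] with M hM N Y
  rw [not_not] at hM
  rw [frobenius_sq_mul, frobenius_sq_eq_sum_sqSum Y, Finset.mul_sum]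
  exact Finset.sum_le_sum fun j _ => hM _

theorem exp_neg_sqrt_le {M : ℕ} (hM : 1 ≤ M) :
    Real.exp (-(√M / 4)) ≤ 6144 * (1 / (M : ℝ) ^ 2) := by
  -- The quartic term of the exponential series already gives M²; 6144 = 4⁴ · 4!.
  have h := Real.pow_div_factorial_le_exp (√M / 4) (by positivity) 4
  have e : (√(M : ℝ) / 4) ^ 4 / (Nat.factorial 4 : ℝ) = (M : ℝ) ^ 2 / 6144 := by
    have : √(M : ℝ) ^ 4 = (M : ℝ) ^ 2 := by
      rw [show 4 = 2 * 2 from rfl, pow_mul, Real.sq_sqrt (by positivity)]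
    rw [div_pow, this]
    norm_num [Nat.factorial]
    ring
  rw [e] at h
  have hM' : (0 : ℝ) < M := by exact_mod_cast hM
  rw [Real.exp_neg, inv_le_comm₀ (Real.exp_pos _) (by positivity)]
  have e' : (6144 * (1 / (M : ℝ) ^ 2))⁻¹ = (M : ℝ) ^ 2 / 6144 := by field_simp
  rwa [e']

/-- The transposed input layer has only d rows, so there is no concentration. The generous threshold
√M has summable failure probability of order exp(-√M/4) and is still negligible against the 1/M of
the backward pass. -/
theorem ae_input_layer_bound (hW : ∀ M, IsGaussianNet P H (s M) (W M)) :
    ∀ᵐ ω ∂P, ∀ᶠ M : ℕ in atTop, ∀ i : Fin (width H d m M (H + 1)) × Fin (width H d m M (H + 1)),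
      sqSum ((weightProd (W M ω) (H + 1) 0)ᵀ *ᵥ pairVec _ i)
        ≤ √M * (s M 0 * sqSum ((weightProd (W M ω) (H + 1) 1)ᵀ *ᵥ pairVec _ i)) := by
  set c : ℝ := (m : ℝ) * m * Real.exp (d * (3 / 8)) with hc
  -- The extra term repairs M = 0, where 1 / M² is 0 by convention.
  have hsum : Summable fun M : ℕ => (c * (6144 * (1 / (M : ℝ) ^ 2)) + if M = 0 then c else 0) := by
    refine Summable.add ?_ (summable_of_ne_finset_zero (s := {0}) fun b hb => ?_)
    · exact ((Real.summable_one_div_nat_pow.2 one_lt_two).mul_left _).mul_left _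
    · simp only [Finset.mem_singleton] at hb
      simp [hb]
  have := ae_eventually_not_of_measureReal_le (P := P)
    (bad := fun M ω => ∃ i, √M * (s M 0 * sqSum ((weightProd (W M ω) (H + 1) 1)ᵀ *ᵥ pairVec _ i))
      < sqSum ((weightProd (W M ω) (H + 1) 0)ᵀ *ᵥ pairVec _ i)) hsum fun M => ?_
  · filter_upwards [this] with ω hω
    filter_upwards [hω] with M hM i
    simp only [not_exists, not_lt] at hM
    exact hM i
  · rw [Set.ofPred_exists]
    refine (measureReal_iUnion_fintype_le _).trans ?_
    calc _ ≤ ∑ _i : Fin (width H d m M (H + 1)) × Fin (width H d m M (H + 1)),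
            Real.exp (d * (3 / 8)) * Real.exp (-(√M / 4)) := by
          refine Finset.sum_le_sum fun i _ => ?_
          have h := (((hW M).layer (Nat.zero_le H)).transpose).upper
            ((hW M).indep_backward (Nat.zero_le _) (pairVec _ i)).1
            (IndepFun.comp_swap ((hW M).indep_backward (Nat.zero_le _) _).2) √M
          rw [← Real.exp_add, ← sub_eq_add_neg]
          simp only [width_zero, Matrix.mulVec_mulVec, ← Matrix.transpose_mul] at h
          simp only [weightProd_left _ (Nat.succ_pos H), sqSum]
          exact h
      _ = c * Real.exp (-(√M / 4)) := by
          rw [Finset.sum_const, Finset.card_univ, Fintype.card_prod, Fintype.card_fin,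
            nsmul_eq_mul, width_last, hc]
          push_cast
          ring
      _ ≤ _ := by
          rcases Nat.eq_zero_or_pos M with rfl | hM
          · simp
          · rw [if_neg (by omega), add_zero]
            exact mul_le_mul_of_nonneg_left (exp_neg_sqrt_le hM) (by positivity)

end Network

end PCNet

/-! ### Good conditioning under the maximal update scaling -/

namespace PCNet

open scoped NNReal ENNReal

/-- The quantitative properties of the weights at hidden width `M` on which the limits rest: the
backward pass to a hidden layer is comparable to `M ^ (-1/2)` times an isometry, the forward pass
to a hidden layer to `M ^ (1/2)` times an isometry, and the hidden weights are bounded. -/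
structure WellConditioned (H M : ℕ) {n : ℕ → ℕ} (W : Weights n) (c C : ℝ) : Prop where
  backward_lower : ∀ l, 1 ≤ l → l ≤ H → ∀ (N : ℕ) (Y : Matrix (Fin (n (H + 1))) (Fin N) ℝ),
    c / M * ‖Y‖ ^ 2 ≤ ‖(weightProd W (H + 1) l)ᵀ * Y‖ ^ 2
  backward_upper : ∀ l, 1 ≤ l → l ≤ H → ∀ (N : ℕ) (Y : Matrix (Fin (n (H + 1))) (Fin N) ℝ),
    ‖(weightProd W (H + 1) l)ᵀ * Y‖ ^ 2 ≤ C / M * ‖Y‖ ^ 2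
  forward_lower : ∀ l, 1 ≤ l → l ≤ H → ∀ (N : ℕ) (Y : Matrix (Fin (n 0)) (Fin N) ℝ),
    c * M * ‖Y‖ ^ 2 ≤ ‖weightProd W l 0 * Y‖ ^ 2
  forward_upper : ∀ l, 1 ≤ l → l ≤ H → ∀ (N : ℕ) (Y : Matrix (Fin (n 0)) (Fin N) ℝ),
    ‖weightProd W l 0 * Y‖ ^ 2 ≤ C * M * ‖Y‖ ^ 2
  hidden : ∀ l, 1 ≤ l → l < H → ∀ (N : ℕ) (Y : Matrix (Fin (n l)) (Fin N) ℝ),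
    ‖W l * Y‖ ^ 2 ≤ C * ‖Y‖ ^ 2

theorem frobenius_sq_one (k : ℕ) : ‖(1 : Matrix (Fin k) (Fin k) ℝ)‖ ^ 2 = k := by
  rw [frobenius_sq]
  simp [Matrix.one_apply, ite_pow]

/-- Four times the square of the Frobenius norm, in terms of sums of basis vectors. -/
theorem four_mul_frobenius_sq {p k : ℕ} (A : Matrix (Fin p) (Fin k) ℝ) :
    4 * ‖A‖ ^ 2 = ∑ j, sqSum (A *ᵥ pairVec k (j, j)) := by
  rw [frobenius_sq_eq_sum_sqSum, Finset.mul_sum]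
  refine Finset.sum_congr rfl fun j _ => ?_
  have e : A *ᵥ pairVec k (j, j) = fun a => A a j + A a j := by
    ext a; simp [pairVec, Matrix.mulVec_add]
  rw [e]
  simp only [sqSum, Finset.mul_sum, Matrix.col_apply]
  exact Finset.sum_congr rfl fun a _ => by ring

/-- The variances of the entries in the maximal update parameterization. -/
structure IsMuPVariance (H : ℕ) (σ : ℝ) (s : ℕ → ℕ → ℝ≥0) : Prop where
  first : ∀ M, 1 ≤ M → (s M 0 : ℝ) = σ ^ 2
  hidden : ∀ M, 1 ≤ M → ∀ l, 1 ≤ l → l < H → (M * s M l : ℝ) = σ ^ 2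
  last : ∀ M, 1 ≤ M → (M * s M H : ℝ) = σ ^ 2 / M

section Scaling

variable {H : ℕ} {σ : ℝ} {s : ℕ → ℕ → ℝ≥0}

/-- Hidden layers contribute σ² each; the output layer supplies the only power of M. -/
theorem IsMuPVariance.prod_backward (hs : IsMuPVariance H σ s) {M : ℕ} (hM : 1 ≤ M) {l : ℕ}
    (h1 : 1 ≤ l) (hl : l ≤ H) :
    ∏ k ∈ Finset.Ico l (H + 1), (M * s M k : ℝ) = (σ ^ 2) ^ (H + 1 - l) / M := by
  rw [Finset.prod_Ico_succ_top hl, hs.last M hM,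
    Finset.prod_congr rfl (g := fun _ => σ ^ 2) fun k hk => ?_]
  · rw [Finset.prod_const, Nat.card_Ico, Nat.sub_add_comm hl, pow_succ (σ ^ 2), mul_div_assoc]
  · rw [Finset.mem_Ico] at hk
    exact hs.hidden M hM k (by omega) hk.2

theorem IsMuPVariance.prod_forward (hs : IsMuPVariance H σ s) {M : ℕ} (hM : 1 ≤ M) {l : ℕ}
    (h1 : 1 ≤ l) (hl : l ≤ H) :
    ∏ k ∈ Finset.range l, (M * s M k : ℝ) = (σ ^ 2) ^ l * M := by
  obtain ⟨l, rfl⟩ : ∃ l', l = l' + 1 := ⟨l - 1, by omega⟩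
  rw [Finset.prod_range_succ', hs.first M hM,
    Finset.prod_congr rfl (g := fun _ => σ ^ 2) fun k hk => ?_]
  · rw [Finset.prod_const, Finset.card_range, pow_succ]; ring
  · rw [Finset.mem_range] at hk
    exact hs.hidden M hM (k + 1) (by omega) (by omega)

end Scaling

/-- Makes the constants independent of the layer, whether σ² is below or above 1. -/
theorem pow_mem_Icc_of_le {x : ℝ} (hx : 0 < x) {k n : ℕ} (hk : k ≤ n) :
    min 1 x ^ n ≤ x ^ k ∧ x ^ k ≤ max 1 x ^ n := by
  have h0 : 0 < min 1 x := lt_min one_pos hx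
  constructor
  · exact (pow_le_pow_of_le_one h0.le (min_le_left _ _) hk).trans
      (pow_le_pow_left₀ h0.le (min_le_right _ _) _)
  · exact (pow_le_pow_left₀ hx.le (le_max_right _ _) _).trans
      (pow_le_pow_right₀ (le_max_left _ _) hk)

/-- The weights of the maximal update parameterization. -/
theorem exists_isGaussianNet {Ω : Type*} [MeasurableSpace Ω] {P : Measure Ω} {H d m : ℕ} {σ : ℝ}
    {W : ∀ M, Ω → Weights (width H d m M)} {w : ∀ M : ℕ, Ω → Weights (width H d m M)} {a b : ℕ → ℝ}
    (hab : IsMuPScale H a b) (hw : IsGaussianInit P H d m σ b w)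
    (hW : ∀ M ω, W M ω = scaledWeights M a (w M ω)) :
    ∃ s : ℕ → ℕ → ℝ≥0, IsMuPVariance H σ s ∧ ∀ M, IsGaussianNet P H (s M) (W M) := by
  -- Rescaling multiplies the variance by M^(-2a), so only the sum a + b matters.
  let s : ℕ → ℕ → ℝ≥0 := fun M l =>
    NNReal.mk ((((M : ℝ) ^ (a l))⁻¹) ^ 2) (sq_nonneg _) *
      Real.toNNReal (σ ^ 2 / (M : ℝ) ^ (2 * b l))
  have hs : ∀ M : ℕ, 1 ≤ M → ∀ l, (s M l : ℝ) = σ ^ 2 / (M : ℝ) ^ (2 * (a l + b l)) := by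
    intro M hM l
    have hM0 : (0 : ℝ) < M := by exact_mod_cast hM
    simp only [s, NNReal.coe_mul, NNReal.coe_mk]
    rw [Real.coe_toNNReal _ (by positivity), mul_add, Real.rpow_add hM0, mul_comm 2 (a l),
      Real.rpow_mul hM0.le (a l), Real.rpow_two]
    field_simp
  refine ⟨s, ⟨fun M hM => ?_, fun M hM l h1 hl => ?_, fun M hM => ?_⟩, fun M => ⟨?_, ?_⟩⟩
  · rw [hs M hM, hab.1]; simp
  · have hM0 : (0 : ℝ) < M := by exact_mod_cast hM
    rw [hs M hM, hab.2.1 l h1 hl]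
    norm_num
    field_simp
  · have hM0 : (0 : ℝ) < M := by exact_mod_cast hM
    rw [hs M hM, hab.2.2]
    norm_num
    field_simp
  · intro l hl i j
    have h := gaussianReal_const_mul ((hw M).1 l hl i j) ((M : ℝ) ^ (a l))⁻¹
    rw [mul_zero] at h
    simpa only [hW, scaledWeights, Matrix.smul_apply, smul_eq_mul] using h
  · have h := (hw M).2.comp (fun p x => ((M : ℝ) ^ (a p.1))⁻¹ * x) (fun p => by fun_prop)
    refine (iIndepFun_congr fun p => ae_of_all _ fun ω => ?_).1 h
    simp [hW, scaledWeights]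

variable {Ω : Type*} [MeasurableSpace Ω] {P : Measure Ω} [IsProbabilityMeasure P] {H d m : ℕ}
  {s : ℕ → ℕ → ℝ≥0} {W : ∀ M, Ω → Weights (width H d m M)} {σ : ℝ}

/-- Almost surely the weights are well conditioned for all large widths. -/
theorem exists_ae_wellConditioned (hσ : 0 < σ) (hs : IsMuPVariance H σ s)
    (hW : ∀ M, IsGaussianNet P H (s M) (W M)) :
    ∃ c C : ℝ, 0 < c ∧ 0 < C ∧ ∀ᵐ ω ∂P, ∀ᶠ M in atTop, WellConditioned H M (W M ω) c C := by
  have hσ2 : 0 < σ ^ 2 := by positivity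
  have hmin : 0 < min 1 (σ ^ 2) := lt_min one_pos hσ2
  have hmax : 0 < max 1 (σ ^ 2) := one_pos.trans_le (le_max_left _ _)
  have hb : ∀ᵐ ω ∂P, ∀ l, 1 ≤ l → l ≤ H → ∀ᶠ M in atTop, ∀ (N : ℕ)
      (Y : Matrix (Fin (width H d m M (H + 1))) (Fin N) ℝ),
      1 / 2 * ((∏ k ∈ Finset.Ico l (H + 1), (M * s M k : ℝ))) * ‖Y‖ ^ 2
        ≤ ‖(weightProd (W M ω) (H + 1) l)ᵀ * Y‖ ^ 2 ∧
      ‖(weightProd (W M ω) (H + 1) l)ᵀ * Y‖ ^ 2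
        ≤ 2 * (∏ k ∈ Finset.Ico l (H + 1), (M * s M k : ℝ)) * ‖Y‖ ^ 2 := by
    refine ae_all_iff.2 fun l => ae_all_iff.2 fun h1 => ae_all_iff.2 fun hl => ?_
    filter_upwards [ae_relClose_backward hW (l := l) (by omega) h1] with ω hω
    exact hω.frobenius (K := m) (fun M => (width_last H d m M).le) fun M => by positivity
  have hf : ∀ᵐ ω ∂P, ∀ l, 1 ≤ l → l ≤ H → ∀ᶠ M in atTop, ∀ (N : ℕ)
      (Y : Matrix (Fin (width H d m M 0)) (Fin N) ℝ),
      1 / 2 * ((∏ k ∈ Finset.range l, (M * s M k : ℝ))) * ‖Y‖ ^ 2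
        ≤ ‖weightProd (W M ω) l 0 * Y‖ ^ 2 ∧
      ‖weightProd (W M ω) l 0 * Y‖ ^ 2
        ≤ 2 * (∏ k ∈ Finset.range l, (M * s M k : ℝ)) * ‖Y‖ ^ 2 := by
    refine ae_all_iff.2 fun l => ae_all_iff.2 fun h1 => ae_all_iff.2 fun hl => ?_
    filter_upwards [ae_relClose_forward hW hl] with ω hω
    exact hω.frobenius (K := d) (fun M => (width_zero H d m M).le) fun M => by positivity
  have ho : ∀ᵐ ω ∂P, ∀ l, 1 ≤ l → l < H → ∀ᶠ M : ℕ in atTop, ∀ (N : ℕ)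
      (Y : Matrix (Fin (width H d m M l)) (Fin N) ℝ),
      ‖W M ω l * Y‖ ^ 2 ≤ 64 * M * s M l * ‖Y‖ ^ 2 :=
    ae_all_iff.2 fun l => ae_all_iff.2 fun h1 => ae_all_iff.2 fun hl => ae_operator_bound hW h1 hl
  -- There are finitely many layers, so one threshold for M serves them all.
  have hIcc : ∀ {q : ℕ → ℕ → Prop}, (∀ l, 1 ≤ l → l ≤ H → ∀ᶠ M in atTop, q l M) →
      ∀ᶠ M in atTop, ∀ l, 1 ≤ l → l ≤ H → q l M := by
    intro q h
    have := (Filter.eventually_all_finset (l := atTop) (Finset.Icc 1 H) (p := fun l M => q l M)).2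
      fun l hl => h l (Finset.mem_Icc.1 hl).1 (Finset.mem_Icc.1 hl).2
    filter_upwards [this] with M hM l h1 h2
    exact hM l (Finset.mem_Icc.2 ⟨h1, h2⟩)
  refine ⟨1 / 2 * min 1 (σ ^ 2) ^ (H + 1), 64 * max 1 (σ ^ 2) ^ (H + 1), by positivity,
    by positivity, ?_⟩
  filter_upwards [hb, hf, ho] with ω hb hf ho
  have ho' := hIcc (q := fun l M => l < H → ∀ (N : ℕ)
      (Y : Matrix (Fin (width H d m M l)) (Fin N) ℝ),
      ‖W M ω l * Y‖ ^ 2 ≤ 64 * M * s M l * ‖Y‖ ^ 2) fun l h1 _ => by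
    by_cases hl : l < H
    · filter_upwards [ho l h1 hl] with M hM _ using hM
    · exact Eventually.of_forall fun _ h => absurd h hl
  filter_upwards [hIcc hb, hIcc hf, ho', eventually_ge_atTop 1] with M hb hf ho hM
  have hM0 : (0 : ℝ) < M := by exact_mod_cast hM
  refine ⟨fun l h1 hl N Y => ?_, fun l h1 hl N Y => ?_, fun l h1 hl N Y => ?_,
    fun l h1 hl N Y => ?_, fun l h1 hl N Y => ?_⟩
  · refine le_trans ?_ (hb l h1 hl N Y).1
    rw [hs.prod_backward hM h1 hl, mul_div_assoc]
    have := (pow_mem_Icc_of_le hσ2 (by omega : H + 1 - l ≤ H + 1)).1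
    gcongr
  · refine (hb l h1 hl N Y).2.trans ?_
    rw [hs.prod_backward hM h1 hl, mul_div_assoc]
    have := (pow_mem_Icc_of_le hσ2 (by omega : H + 1 - l ≤ H + 1)).2
    gcongr
    norm_num
  · refine le_trans ?_ (hf l h1 hl N Y).1
    rw [hs.prod_forward hM h1 hl, ← mul_assoc]
    have := (pow_mem_Icc_of_le hσ2 (by omega : l ≤ H + 1)).1
    gcongr
  · refine (hf l h1 hl N Y).2.trans ?_
    rw [hs.prod_forward hM h1 hl, ← mul_assoc]
    have := (pow_mem_Icc_of_le hσ2 (by omega : l ≤ H + 1)).2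
    gcongr
    norm_num
  · refine (ho l h1 hl.le hl N Y).trans ?_
    rw [mul_assoc 64 (M : ℝ), hs.hidden M hM l h1 hl]
    have := (pow_mem_Icc_of_le hσ2 (by omega : 1 ≤ H + 1)).2
    rw [pow_one] at this
    gcongr

/-- Almost surely the output of the network at initialization vanishes in the limit. -/
theorem ae_tendsto_weightProd_zero (hH : 1 ≤ H) (hσ : 0 < σ) (hs : IsMuPVariance H σ s)
    (hW : ∀ M, IsGaussianNet P H (s M) (W M)) :
    ∀ᵐ ω ∂P, Tendsto (fun M => ‖weightProd (W M ω) (H + 1) 0‖) atTop (𝓝 0) := by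
  obtain ⟨c, C, -, hC, hwc⟩ := exists_ae_wellConditioned hσ hs hW
  filter_upwards [hwc, ae_input_layer_bound hW] with ω hwc hin
  have hb : ∀ᶠ M : ℕ in atTop, ‖weightProd (W M ω) (H + 1) 0‖ ^ 2 ≤ σ ^ 2 * C * m * (√M)⁻¹ := by
    filter_upwards [hwc, hin, eventually_ge_atTop 1] with M hwc hin hM
    have hM0 : (0 : ℝ) < M := by exact_mod_cast hM
    have h1 : ‖(weightProd (W M ω) (H + 1) 0)ᵀ‖ ^ 2
        ≤ √M * σ ^ 2 * ‖(weightProd (W M ω) (H + 1) 1)ᵀ‖ ^ 2 := by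
      have h4 : 4 * ‖(weightProd (W M ω) (H + 1) 0)ᵀ‖ ^ 2
          ≤ √M * σ ^ 2 * (4 * ‖(weightProd (W M ω) (H + 1) 1)ᵀ‖ ^ 2) := by
        rw [four_mul_frobenius_sq, four_mul_frobenius_sq, Finset.mul_sum]
        refine Finset.sum_le_sum fun j _ => ?_
        have := hin (j, j)
        rwa [hs.first M hM, ← mul_assoc] at this
      linarith
    -- Testing on the identity, of squared norm m, bounds the Frobenius norm of the product itself.
    have h2 := hwc.backward_upper 1 le_rfl hH (width H d m M (H + 1)) 1
    have hm : ((width H d m M (H + 1) : ℕ) : ℝ) = m := by rw [width_last]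
    rw [Matrix.mul_one, frobenius_sq_one, hm] at h2
    rw [Matrix.frobenius_norm_transpose] at h1
    refine h1.trans ((mul_le_mul_of_nonneg_left h2 (by positivity)).trans (le_of_eq ?_))
    have e : (M : ℝ) = √M * √M := (Real.mul_self_sqrt hM0.le).symm
    have h0 : √(M : ℝ) ≠ 0 := (Real.sqrt_pos.2 hM0).ne'
    have e2 : √(M : ℝ) / M = (√M)⁻¹ := Real.sqrt_div_self'.trans (one_div _)
    calc _ = σ ^ 2 * C * m * (√(M : ℝ) / M) := by ring
      _ = _ := by rw [e2]
  have hlim : Tendsto (fun M : ℕ => σ ^ 2 * C * m * (√(M : ℝ))⁻¹) atTop (𝓝 0) := by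
    rw [← mul_zero (σ ^ 2 * C * m)]
    exact (tendsto_inv_atTop_zero.comp
      (Real.tendsto_sqrt_atTop.comp tendsto_natCast_atTop_atTop)).const_mul _
  have hsq := squeeze_zero' (Eventually.of_forall fun M => sq_nonneg _) hb hlim
  have := hsq.sqrt
  simpa [Real.sqrt_sq (norm_nonneg _)] using this

end PCNet

namespace PCNet

/-! ### Deterministic algebra of the preconditioner and the errors -/

section Algebra

variable {n : ℕ → ℕ} {N H : ℕ} {γ : ℕ → ℝ} {W : Weights n}

theorem trace_transpose_mul_self {p q : ℕ} (A : Matrix (Fin p) (Fin q) ℝ) :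
    (Aᵀ * A).trace = ‖A‖ ^ 2 := by
  rw [frobenius_sq, Finset.sum_comm]
  simp [Matrix.trace, Matrix.mul_apply, sq]

theorem frobenius_add_sq {p q : ℕ} (A B : Matrix (Fin p) (Fin q) ℝ) :
    ‖A + B‖ ^ 2 = ‖A‖ ^ 2 + 2 * (Aᵀ * B).trace + ‖B‖ ^ 2 := by
  have h : (Bᵀ * A).trace = (Aᵀ * B).trace := by
    rw [← Matrix.trace_transpose, Matrix.transpose_mul, Matrix.transpose_transpose]
  rw [← trace_transpose_mul_self, ← trace_transpose_mul_self, ← trace_transpose_mul_self,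
    Matrix.transpose_add, Matrix.add_mul, Matrix.mul_add, Matrix.mul_add, Matrix.trace_add,
    Matrix.trace_add, Matrix.trace_add, h]
  ring

/-- Positive semidefiniteness of C_γ in explicit form; it gives the stability of I + C_γ and the
lower bound on ‖C_γ‖. -/
theorem trace_transpose_mul_precond (E : Matrix (Fin (n (H + 1))) (Fin N) ℝ) :
    (Eᵀ * (precond H γ W * E)).trace
      = ∑ l ∈ Finset.range H, γ H / γ l * ‖(weightProd W (H + 1) (l + 1))ᵀ * E‖ ^ 2 := by
  rw [precond, Matrix.sum_mul, Matrix.mul_sum, Matrix.trace_sum]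
  refine Finset.sum_congr rfl fun l _ => ?_
  rw [← trace_transpose_mul_self, Matrix.transpose_mul, Matrix.transpose_transpose,
    Matrix.smul_mul, Matrix.mul_smul, Matrix.trace_smul, smul_eq_mul]
  simp only [Matrix.mul_assoc]

/-- Expanding the square, the cross term is twice a nonnegative quadratic form. This replaces any
explicit inverse of I + C_γ. -/
theorem norm_le_norm_add_precond (hpos : ∀ l ≤ H, 0 < γ l)
    (E : Matrix (Fin (n (H + 1))) (Fin N) ℝ) : ‖E‖ ≤ ‖E + precond H γ W * E‖ := by
  refine (pow_le_pow_iff_left₀ (norm_nonneg _) (norm_nonneg _) two_ne_zero).1 ?_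
  rw [frobenius_add_sq, trace_transpose_mul_precond]
  have : 0 ≤ ∑ l ∈ Finset.range H, γ H / γ l * ‖(weightProd W (H + 1) (l + 1))ᵀ * E‖ ^ 2 := by
    refine Finset.sum_nonneg fun l hl => ?_
    have h1 := hpos l (Finset.mem_range.1 hl).le
    have h2 := hpos H le_rfl
    positivity
  linarith [sq_nonneg ‖precond H γ W * E‖]

theorem eq_zero_of_add_precond_eq_zero (hpos : ∀ l ≤ H, 0 < γ l)
    {E : Matrix (Fin (n (H + 1))) (Fin N) ℝ} (h : E + precond H γ W * E = 0) : E = 0 := by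
  have := norm_le_norm_add_precond (W := W) hpos E
  rw [h, norm_zero] at this
  exact norm_le_zero_iff.1 this

theorem exists_add_precond_eq (hpos : ∀ l ≤ H, 0 < γ l)
    (R : Matrix (Fin (n (H + 1))) (Fin N) ℝ) :
    ∃ E : Matrix (Fin (n (H + 1))) (Fin N) ℝ, E + precond H γ W * E = R := by
  let T : Matrix (Fin (n (H + 1))) (Fin N) ℝ →ₗ[ℝ] Matrix (Fin (n (H + 1))) (Fin N) ℝ :=
    { toFun := fun E => E + precond H γ W * E
      map_add' := fun A B => by rw [Matrix.mul_add]; abel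
      map_smul' := fun c A => by rw [Matrix.mul_smul, RingHom.id_apply, smul_add] }
  have hinj : Function.Injective T := by
    rw [← LinearMap.ker_eq_bot, LinearMap.ker_eq_bot']
    exact fun E hE => eq_zero_of_add_precond_eq_zero hpos hE
  exact LinearMap.injective_iff_surjective.1 hinj R

/-- The states, in terms of the local errors. -/
theorem state_eq_forward_add {v : States n N} {x : Matrix (Fin (n 0)) (Fin N) ℝ} (hx : v 0 = x)
    (j : ℕ) : v j = forward W x j
      + ∑ k ∈ Finset.range j, weightProd W j (k + 1) * localError W v k := by
  induction j with
  | zero => simp [forward, weightProd_self, hx]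
  | succ j ih =>
    have h : v (j + 1) = W j * v j + localError W v j := by rw [localError]; abel
    rw [h, Finset.sum_range_succ, weightProd_self, Matrix.one_mul, ← add_assoc]
    congr 1
    conv_lhs => rw [ih]
    rw [Matrix.mul_add, forward, forward, weightProd_succ W (Nat.zero_le j), Matrix.mul_assoc,
      Matrix.mul_sum]
    congr 1
    refine Finset.sum_congr rfl fun k hk => ?_
    rw [weightProd_succ W (Finset.mem_range.1 hk : k + 1 ≤ j), Matrix.mul_assoc]

/-- The output residual, when the local errors are propagated backwards from the output error. -/
theorem residual_eq {v : States n N} {x : Matrix (Fin (n 0)) (Fin N) ℝ} (hx : v 0 = x)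
    (he : ∀ l < H, localError W v l
      = (γ H / γ l) • ((weightProd W (H + 1) (l + 1))ᵀ * localError W v H)) :
    v (H + 1) - forward W x (H + 1)
      = localError W v H + precond H γ W * localError W v H := by
  rw [state_eq_forward_add (W := W) hx (H + 1), add_sub_cancel_left, Finset.sum_range_succ,
    weightProd_self, Matrix.one_mul, add_comm _ (localError W v H), precond, Matrix.sum_mul]
  congr 1
  refine Finset.sum_congr rfl fun l hl => ?_
  rw [he l (Finset.mem_range.1 hl), Matrix.mul_smul, Matrix.smul_mul, Matrix.mul_assoc]

theorem isInferenceFixedPoint_iff {x : Matrix (Fin (n 0)) (Fin N) ℝ}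
    {y : Matrix (Fin (n (H + 1))) (Fin N) ℝ} {v : States n N} :
    IsInferenceFixedPoint H γ W x y v ↔ v 0 = x ∧ v (H + 1) = y ∧ ∀ l < H,
      γ l • localError W v l = γ (l + 1) • ((W (l + 1))ᵀ * localError W v (l + 1)) := by
  refine and_congr_right fun _ => and_congr_right fun _ => ?_
  rw [Function.IsFixedPt, funext_iff]
  constructor
  · intro h l hl
    have h1 := h (l + 1)
    rw [inferenceStep, if_pos hl, sub_add, sub_eq_self, sub_eq_zero] at h1
    exact h1
  · rintro h (_ | l)
    · rfl
    · rw [inferenceStep]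
      split_ifs with hl
      · rw [h l hl, sub_add_cancel]
      · rfl

/-! ### Existence, uniqueness and form of the fixed point -/

section FixedPoint

variable {x : Matrix (Fin (n 0)) (Fin N) ℝ} {y : Matrix (Fin (n (H + 1))) (Fin N) ℝ}
  {v : States n N}

theorem IsInferenceFixedPoint.error_eq (hv : IsInferenceFixedPoint H γ W x y v) {l : ℕ}
    (hl : l ≤ H) : γ l • localError W v l
      = γ H • ((weightProd W (H + 1) (l + 1))ᵀ * localError W v H) := by
  induction hl using Nat.decreasingInduction with
  | self => rw [weightProd_self, Matrix.transpose_one, Matrix.one_mul]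
  | of_succ l hl ih =>
    rw [(isInferenceFixedPoint_iff.1 hv).2.2 l hl, ← Matrix.mul_smul, ih,
      weightProd_left W (by omega : l + 1 < H + 1), Matrix.transpose_mul, Matrix.mul_smul,
      Matrix.mul_assoc]

theorem IsInferenceFixedPoint.error_eq' (hpos : ∀ l ≤ H, 0 < γ l)
    (hv : IsInferenceFixedPoint H γ W x y v) {l : ℕ} (hl : l ≤ H) : localError W v l
      = (γ H / γ l) • ((weightProd W (H + 1) (l + 1))ᵀ * localError W v H) := by
  have h := hv.error_eq hl
  have h0 := (hpos l hl).ne'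
  rw [div_eq_inv_mul, mul_smul, ← h, smul_smul, inv_mul_cancel₀ h0, one_smul]

theorem IsInferenceFixedPoint.residual_eq (hpos : ∀ l ≤ H, 0 < γ l)
    (hv : IsInferenceFixedPoint H γ W x y v) :
    y - forward W x (H + 1) = localError W v H + precond H γ W * localError W v H := by
  rw [← hv.2.1]
  exact PCNet.residual_eq hv.1 fun l hl => hv.error_eq' hpos hl.le

/-- Both output errors solve the same equation for I + C_γ, and the output error determines all
other errors, hence the states. -/
theorem IsInferenceFixedPoint.unique (hpos : ∀ l ≤ H, 0 < γ l) {v' : States n N}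
    (hv : IsInferenceFixedPoint H γ W x y v) (hv' : IsInferenceFixedPoint H γ W x y v') {l : ℕ}
    (hl : l ≤ H + 1) : v' l = v l := by
  have hH : localError W v' H = localError W v H := by
    rw [← sub_eq_zero]
    refine eq_zero_of_add_precond_eq_zero (W := W) (γ := γ) hpos ?_
    rw [Matrix.mul_sub, sub_add_sub_comm, ← hv.residual_eq hpos, ← hv'.residual_eq hpos, sub_self]
  rw [state_eq_forward_add (W := W) hv.1, state_eq_forward_add (W := W) hv'.1]
  congr 1
  refine Finset.sum_congr rfl fun k hk => ?_
  have hk : k ≤ H := by have := Finset.mem_range.1 hk; omega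
  rw [hv.error_eq' hpos hk, hv'.error_eq' hpos hk, hH]

/-- The states with prescribed input and prescribed local errors. -/
def statesOfErrors (W : Weights n) (x : Matrix (Fin (n 0)) (Fin N) ℝ)
    (e : ∀ l : ℕ, Matrix (Fin (n (l + 1))) (Fin N) ℝ) : States n N
  | 0 => x
  | l + 1 => W l * statesOfErrors W x e l + e l

theorem localError_statesOfErrors (e : ∀ l : ℕ, Matrix (Fin (n (l + 1))) (Fin N) ℝ) (l : ℕ) :
    localError W (statesOfErrors W x e) l = e l := by
  rw [localError, statesOfErrors, add_sub_cancel_left]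

/-- Solve (I + C_γ) E = y - f, propagate E backwards to prescribe all errors, then integrate the
states forward; the residual identity makes the last state equal y. -/
theorem exists_isInferenceFixedPoint (hpos : ∀ l ≤ H, 0 < γ l)
    (x : Matrix (Fin (n 0)) (Fin N) ℝ) (y : Matrix (Fin (n (H + 1))) (Fin N) ℝ) :
    ∃ v, IsInferenceFixedPoint H γ W x y v := by
  obtain ⟨E, hE⟩ := exists_add_precond_eq (W := W) hpos (y - forward W x (H + 1))
  set e : ∀ l : ℕ, Matrix (Fin (n (l + 1))) (Fin N) ℝ := fun l =>
    (γ H / γ l) • ((weightProd W (H + 1) (l + 1))ᵀ * E) with he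
  have heH : e H = E := by
    simp only [he]
    rw [div_self (hpos H le_rfl).ne', one_smul, weightProd_self, Matrix.transpose_one,
      Matrix.one_mul]
  have hle := localError_statesOfErrors (W := W) (x := x) e
  refine ⟨statesOfErrors W x e, isInferenceFixedPoint_iff.2 ⟨rfl, ?_, fun l hl => ?_⟩⟩
  · have h := PCNet.residual_eq (W := W) (γ := γ) (H := H) (v := statesOfErrors W x e) (x := x) rfl
      fun l _ => by rw [hle, hle, heH]
    rw [hle, heH, hE] at h
    exact sub_left_injective h
  · have h1 := (hpos l hl.le).ne'
    have h2 := (hpos (l + 1) hl).ne'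
    rw [hle, hle]
    simp only [he]
    rw [weightProd_left W (by omega : l + 1 < H + 1), Matrix.transpose_mul, smul_smul,
      Matrix.mul_smul, smul_smul, mul_div_cancel₀ _ h1, mul_div_cancel₀ _ h2, Matrix.mul_assoc]

end FixedPoint

/-! ### The two weight gradients in closed form -/

section Gradient

theorem hasDerivAt_half_norm_sq {p q : ℕ} (A B : Matrix (Fin p) (Fin q) ℝ) :
    HasDerivAt (fun t : ℝ => 1 / 2 * ‖A - t • B‖ ^ 2) (-(Aᵀ * B).trace) 0 := by
  have h : (fun t : ℝ => 1 / 2 * ‖A - t • B‖ ^ 2)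
      = fun t => 1 / 2 * ‖A‖ ^ 2 - t * (Aᵀ * B).trace + t ^ 2 * (1 / 2 * ‖B‖ ^ 2) := by
    ext t
    rw [sub_eq_add_neg, frobenius_add_sq, norm_neg, norm_smul, mul_pow, Real.norm_eq_abs, sq_abs,
      Matrix.mul_neg, Matrix.mul_smul, Matrix.trace_neg, Matrix.trace_smul, smul_eq_mul]
    ring
  rw [h]
  have h1 := (((hasDerivAt_id (0 : ℝ)).mul_const (Aᵀ * B).trace).const_sub
    (1 / 2 * ‖A‖ ^ 2)).add (((hasDerivAt_id (0 : ℝ)).pow 2).mul_const (1 / 2 * ‖B‖ ^ 2))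
  exact h1.congr_deriv (by simp)

theorem trace_transpose_mul_single {p q r : ℕ} (A : Matrix (Fin p) (Fin r) ℝ)
    (B : Matrix (Fin q) (Fin r) ℝ) (i : Fin p) (j : Fin q) :
    (Aᵀ * (Matrix.single i j (1 : ℝ) * B)).trace = (A * Bᵀ) i j := by
  rw [← Matrix.mul_assoc, Matrix.trace_mul_comm, ← Matrix.mul_assoc, Matrix.trace_mul_comm,
    Matrix.trace_single_mul, one_smul, ← Matrix.transpose_apply (B * Aᵀ),
    Matrix.transpose_mul, Matrix.transpose_transpose]

theorem pcGrad_eq {v : States n N} {y : Matrix (Fin (n (H + 1))) (Fin N) ℝ} (hy : v (H + 1) = y)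
    {l : ℕ} (hl : l ≤ H) :
    pcGrad H γ y v W l = -((γ l • localError W v l) * (v l)ᵀ) := by
  ext i j
  -- With the output clamped, the loss term is just one more local error term.
  have hF : ∀ V : Weights n, freeEnergy H γ y v V
      = ∑ k ∈ Finset.range (H + 1), γ k * (1 / 2 * ‖localError V v k‖ ^ 2) := by
    intro V
    rw [freeEnergy, Finset.sum_range_succ, add_comm, squaredLoss, localError, hy]
  rw [pcGrad, weightGrad, Matrix.of_apply]
  simp only [hF]
  have hd : ∀ k ∈ Finset.range (H + 1), HasDerivAt (fun t : ℝ => γ k * (1 / 2 * ‖localError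
      (Function.update W l (W l + t • Matrix.single i j (1 : ℝ))) v k‖ ^ 2))
      (if k = l then γ l * (-(localError W v l * (v l)ᵀ) i j) else 0) 0 := by
    intro k _
    by_cases hk : k = l
    · subst hk
      rw [if_pos rfl]
      simp only [localError, Function.update_self]
      rw [← trace_transpose_mul_single]
      have := (hasDerivAt_half_norm_sq (v (k + 1) - W k * v k)
        (Matrix.single i j (1 : ℝ) * v k)).const_mul (γ k)
      simpa only [Matrix.add_mul, Matrix.smul_mul, sub_add_eq_sub_sub] using this
    · rw [if_neg hk]
      simp only [localError, Function.update_of_ne hk]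
      exact hasDerivAt_const _ _
  rw [(HasDerivAt.fun_sum hd).deriv, Finset.sum_ite_eq', if_pos (Finset.mem_range.2 (by omega))]
  simp [Matrix.smul_mul]

theorem weightProd_split (W : Weights n) {i l j : ℕ} (hi : i ≤ l) (hj : l < j) :
    weightProd W j i = weightProd W j (l + 1) * W l * weightProd W l i := by
  induction j, hj using Nat.le_induction with
  | base => rw [weightProd_self, Matrix.one_mul, weightProd_succ W hi]
  | succ j hj ih =>
    rw [weightProd_succ W (by omega), ih, weightProd_succ W (by omega : l + 1 ≤ j)]
    simp only [Matrix.mul_assoc]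

theorem gdGrad_eq {x : Matrix (Fin (n 0)) (Fin N) ℝ} {y : Matrix (Fin (n (H + 1))) (Fin N) ℝ}
    {l : ℕ} (hl : l ≤ H) :
    gdGrad H x y W l = -(backpropError H x y W l * (forward W x l)ᵀ) := by
  ext i j
  rw [gdGrad, weightGrad, Matrix.of_apply]
  -- Splitting the product at layer l shows that the output is affine in `W l`, so the loss is a
  -- quadratic polynomial in t.
  have hf : ∀ t : ℝ, trainLoss H x y (Function.update W l (W l + t • Matrix.single i j (1 : ℝ)))
      = 1 / 2 * ‖(y - forward W x (H + 1)) - t • (weightProd W (H + 1) (l + 1) *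
        (Matrix.single i j (1 : ℝ) * forward W x l))‖ ^ 2 := by
    intro t
    rw [trainLoss, squaredLoss]
    congr 3
    simp only [forward]
    rw [weightProd_split _ (Nat.zero_le l) (Nat.lt_succ_of_le hl),
      weightProd_split W (Nat.zero_le l) (Nat.lt_succ_of_le hl), Function.update_self,
      weightProd_congr (W := Function.update W l _) (W' := W) (i := l + 1) (by omega)
        (fun k h1 _ => Function.update_of_ne (by omega) _ _),
      weightProd_congr (W := Function.update W l _) (W' := W) (i := 0) (j := l) (by omega)
        (fun k _ h2 => Function.update_of_ne (by omega) _ _)]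
    simp only [Matrix.mul_add, Matrix.add_mul, Matrix.mul_smul, Matrix.smul_mul, Matrix.mul_assoc]
    abel
  simp only [hf]
  rw [(hasDerivAt_half_norm_sq _ _).deriv, ← Matrix.mul_assoc, ← Matrix.transpose_transpose
    (weightProd W (H + 1) (l + 1)), ← Matrix.transpose_mul, trace_transpose_mul_single]
  rfl

end Gradient

end Algebra

end PCNet

namespace PCNet

/-! ### Estimates at a fixed width -/

section Bounds

variable {n : ℕ → ℕ} {N H M : ℕ} {γ : ℕ → ℝ} {W : Weights n} {c C B : ℝ}
  {x : Matrix (Fin (n 0)) (Fin N) ℝ} {y : Matrix (Fin (n (H + 1))) (Fin N) ℝ} {v : States n N}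

theorem le_sqrt_mul_of_sq_le {a b k : ℝ} (hb : 0 ≤ b) (h : a ^ 2 ≤ k * b ^ 2) :
    a ≤ √k * b := by
  have := Real.abs_le_sqrt h
  rw [mul_comm k, Real.sqrt_mul (sq_nonneg b), Real.sqrt_sq hb, mul_comm] at this
  exact (le_abs_self a).trans this

/-- The condition number of the backward pass is bounded. -/
theorem WellConditioned.backward_mul_le (hW : WellConditioned H M W c C) (hc : 0 < c)
    (hM : 1 ≤ M) {l : ℕ} (hl : l ≤ H) {q r : ℕ} (Y : Matrix (Fin (n (H + 1))) (Fin q) ℝ)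
    (Z : Matrix (Fin (n (H + 1))) (Fin r) ℝ) :
    ‖(weightProd W (H + 1) (l + 1))ᵀ * Z‖ * ‖Y‖
      ≤ (1 + √(C / c)) * (‖(weightProd W (H + 1) (l + 1))ᵀ * Y‖ * ‖Z‖) := by
  -- At the output layer the product is the identity; the summand 1 in the constant covers this
  -- case.
  rcases hl.eq_or_lt with rfl | hl
  · rw [weightProd_self, Matrix.transpose_one, Matrix.one_mul, Matrix.one_mul, mul_comm]
    exact le_mul_of_one_le_left (by positivity) (by linarith [Real.sqrt_nonneg (C / c)])
  · have hM0 : (0 : ℝ) < M := by exact_mod_cast hM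
    have h1 := hW.backward_upper (l + 1) (by omega) hl _ Z
    have h2 := hW.backward_lower (l + 1) (by omega) hl _ Y
    have h3 : ‖(weightProd W (H + 1) (l + 1))ᵀ * Z‖ * ‖Y‖
        ≤ √(C / c) * (‖(weightProd W (H + 1) (l + 1))ᵀ * Y‖ * ‖Z‖) := by
      refine le_sqrt_mul_of_sq_le (by positivity) ?_
      rcases (norm_nonneg Z).eq_or_lt with hZ | hZ
      · rw [← hZ] at h1 ⊢
        have : ‖(weightProd W (H + 1) (l + 1))ᵀ * Z‖ = 0 := by
          refine pow_eq_zero_iff two_ne_zero |>.1 (le_antisymm (by simpa using h1) (sq_nonneg _))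
        simp [this]
      · have hC : 0 ≤ C / M := by
          by_contra hneg
          have := mul_neg_of_neg_of_pos (not_le.1 hneg) (pow_pos hZ 2)
          linarith [sq_nonneg ‖(weightProd W (H + 1) (l + 1))ᵀ * Z‖]
        calc (‖(weightProd W (H + 1) (l + 1))ᵀ * Z‖ * ‖Y‖) ^ 2
            = ‖(weightProd W (H + 1) (l + 1))ᵀ * Z‖ ^ 2 * ‖Y‖ ^ 2 := by ring
          _ ≤ (C / M * ‖Z‖ ^ 2) * ‖Y‖ ^ 2 := by gcongr
          _ = C / M * ‖Z‖ ^ 2 * (M / c) * (c / M * ‖Y‖ ^ 2) := by field_simp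
          _ ≤ C / M * ‖Z‖ ^ 2 * (M / c) * ‖(weightProd W (H + 1) (l + 1))ᵀ * Y‖ ^ 2 := by gcongr
          _ = C / c * (‖(weightProd W (H + 1) (l + 1))ᵀ * Y‖ * ‖Z‖) ^ 2 := by field_simp
    have h4 : 0 ≤ ‖(weightProd W (H + 1) (l + 1))ᵀ * Y‖ * ‖Z‖ := by positivity
    linarith

theorem WellConditioned.norm_precond_le (hW : WellConditioned H M W c C)
    (hpos : ∀ l ≤ H, 0 < γ l) (hB : ∀ l < H, (γ l)⁻¹ ≤ B) :
    ‖precond H γ W‖ ≤ H * (γ H * B * (C / M * n (H + 1))) := by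
  rw [precond]
  refine (norm_sum_le _ _).trans ?_
  refine (Finset.sum_le_card_nsmul _ _ (γ H * B * (C / M * n (H + 1))) fun l hl => ?_).trans
    (by rw [Finset.card_range, nsmul_eq_mul])
  have hl := Finset.mem_range.1 hl
  have hl0 := hpos l hl.le
  have hH0 := hpos H le_rfl
  have h2 := hW.backward_upper (l + 1) (by omega) hl (n (H + 1)) 1
  rw [Matrix.mul_one, frobenius_sq_one] at h2
  rw [norm_smul, Real.norm_of_nonneg (by positivity), div_eq_mul_inv]
  have h3 : ‖weightProd W (H + 1) (l + 1) * (weightProd W (H + 1) (l + 1))ᵀ‖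
      ≤ ‖(weightProd W (H + 1) (l + 1))ᵀ‖ ^ 2 := by
    refine (Matrix.frobenius_norm_mul _ _).trans (le_of_eq ?_)
    rw [Matrix.frobenius_norm_transpose, sq]
  have h4 := hB l hl
  have h5 : 0 ≤ B := (inv_pos.2 hl0).le.trans h4
  exact mul_le_mul (mul_le_mul_of_nonneg_left h4 hH0.le) (h3.trans h2) (norm_nonneg _)
    (mul_nonneg hH0.le h5)

theorem WellConditioned.le_norm_precond (hW : WellConditioned H M W c C) (hH : 1 ≤ H)
    (hm : 1 ≤ n (H + 1)) (hpos : ∀ l ≤ H, 0 < γ l) (hB : γ 0 ≤ B) :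
    γ H / B * (c / M) ≤ ‖precond H γ W‖ := by
  -- Testing the quadratic form on one basis vector and keeping only the lowest layer's term already
  -- gives the right order.
  let E : Matrix (Fin (n (H + 1))) (Fin 1) ℝ :=
    Matrix.of fun i _ => if i = ⟨0, hm⟩ then 1 else 0
  have hE : ‖E‖ = 1 := by
    have h : ‖E‖ ^ 2 = 1 := by
      rw [frobenius_sq]
      simp [E, ite_pow]
    exact (pow_eq_one_iff_of_nonneg (norm_nonneg _) two_ne_zero).1 h
  have h0 := hpos 0 (Nat.zero_le H)
  have hH0 := hpos H le_rfl
  have h1 : γ H / B * (c / M) ≤ (Eᵀ * (precond H γ W * E)).trace := by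
    rw [trace_transpose_mul_precond]
    have h2 := hW.backward_lower 1 le_rfl hH _ E
    rw [hE, one_pow, mul_one] at h2
    calc γ H / B * (c / M) ≤ γ H / B * ‖(weightProd W (H + 1) 1)ᵀ * E‖ ^ 2 := by
          have := h0.trans_le hB
          gcongr
      _ ≤ γ H / γ 0 * ‖(weightProd W (H + 1) 1)ᵀ * E‖ ^ 2 := by gcongr
      _ ≤ _ := Finset.single_le_sum
          (f := fun l => γ H / γ l * ‖(weightProd W (H + 1) (l + 1))ᵀ * E‖ ^ 2)
          (fun l hl => by
            have := hpos l (Finset.mem_range.1 hl).le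
            positivity) (Finset.mem_range.2 hH)
  have htr : ∀ A : Matrix (Fin 1) (Fin 1) ℝ, A.trace ≤ ‖A‖ := by
    intro A
    have h : ‖A‖ ^ 2 = A.trace ^ 2 := by
      rw [frobenius_sq]; simp [Matrix.trace]
    exact (le_abs_self _).trans (abs_le_of_sq_le_sq h.symm.le (norm_nonneg _))
  calc _ ≤ _ := h1
    _ ≤ ‖Eᵀ * (precond H γ W * E)‖ := htr _
    _ ≤ ‖Eᵀ‖ * (‖precond H γ W‖ * ‖E‖) := (Matrix.frobenius_norm_mul _ _).trans
        (mul_le_mul_of_nonneg_left (Matrix.frobenius_norm_mul _ _) (norm_nonneg _))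
    _ = ‖precond H γ W‖ := by rw [Matrix.frobenius_norm_transpose, hE]; ring

/-- The errors at the fixed point are close to the backpropagated errors, relative to the latter. -/
theorem WellConditioned.norm_error_sub_le (hW : WellConditioned H M W c C) (hc : 0 < c)
    (hM : 1 ≤ M) (hpos : ∀ l ≤ H, 0 < γ l) (hv : IsInferenceFixedPoint H γ W x y v) {l : ℕ}
    (hl : l ≤ H) : ‖γ l • localError W v l - γ H • backpropError H x y W l‖
      ≤ γ H * (1 + √(C / c)) * ‖precond H γ W‖ * ‖backpropError H x y W l‖ := by
  set R := y - forward W x (H + 1) with hR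
  have hres := hv.residual_eq hpos
  have hH0 := hpos H le_rfl
  have hle : ‖localError W v H‖ ≤ ‖R‖ := by
    rw [hR, hres]; exact norm_le_norm_add_precond hpos _
  have hbp : backpropError H x y W l = (weightProd W (H + 1) (l + 1))ᵀ * R := rfl
  -- Substituting y - f = (I + C_γ) e_L cancels everything but the C_γ term.
  have e : γ l • localError W v l - γ H • backpropError H x y W l
      = -(γ H • ((weightProd W (H + 1) (l + 1))ᵀ * (precond H γ W * localError W v H))) := by
    rw [hv.error_eq hl, hbp, hR, hres, Matrix.mul_add, smul_add]
    abel
  rw [e, norm_neg, norm_smul, Real.norm_of_nonneg hH0.le, mul_assoc, mul_assoc]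
  refine mul_le_mul_of_nonneg_left ?_ hH0.le
  have hCe : ‖precond H γ W * localError W v H‖ ≤ ‖precond H γ W‖ * ‖R‖ :=
    (Matrix.frobenius_norm_mul _ _).trans (mul_le_mul_of_nonneg_left hle (norm_nonneg _))
  rcases (norm_nonneg R).eq_or_lt with h0 | h0
  · rw [← h0, mul_zero] at hCe
    have hz := norm_le_zero_iff.1 hCe
    rw [hz, Matrix.mul_zero, norm_zero]
    positivity
  · have h1 := hW.backward_mul_le hc hM hl R (precond H γ W * localError W v H)
    refine le_of_mul_le_mul_right (h1.trans ?_) h0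
    calc (1 + √(C / c)) * (‖(weightProd W (H + 1) (l + 1))ᵀ * R‖
          * ‖precond H γ W * localError W v H‖)
        ≤ (1 + √(C / c)) * (‖(weightProd W (H + 1) (l + 1))ᵀ * R‖
          * (‖precond H γ W‖ * ‖R‖)) := by gcongr
      _ = _ := by rw [hbp]; ring

theorem WellConditioned.norm_backward_le (hW : WellConditioned H M W c C) {l : ℕ} (hl : l < H)
    {q : ℕ} (Y : Matrix (Fin (n (H + 1))) (Fin q) ℝ) :
    ‖(weightProd W (H + 1) (l + 1))ᵀ * Y‖ ≤ √(C / M) * ‖Y‖ :=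
  le_sqrt_mul_of_sq_le (norm_nonneg _) (hW.backward_upper (l + 1) (by omega) hl _ Y)

theorem WellConditioned.norm_forward_le (hW : WellConditioned H M W c C) (hM : 1 ≤ M) {l : ℕ}
    (hl : l ≤ H) : ‖forward W x l‖ ≤ (1 + √C) * √M * ‖x‖ := by
  have hM1 : (1 : ℝ) ≤ √M := Real.one_le_sqrt.2 (by exact_mod_cast hM)
  have hC := Real.sqrt_nonneg C
  rcases Nat.eq_zero_or_pos l with rfl | h1
  · rw [forward, weightProd_self, Matrix.one_mul]
    refine le_mul_of_one_le_left (norm_nonneg _) ?_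
    nlinarith
  · have h := le_sqrt_mul_of_sq_le (norm_nonneg _) (hW.forward_upper l h1 hl _ x)
    rw [Real.sqrt_mul' _ (Nat.cast_nonneg M)] at h
    refine h.trans ?_
    gcongr
    linarith

/-- The states at the fixed point are close to those of the forward pass. -/
theorem WellConditioned.norm_state_sub_le (hW : WellConditioned H M W c C)
    (hpos : ∀ l ≤ H, 0 < γ l) (hB : ∀ l < H, (γ l)⁻¹ ≤ B)
    (hv : IsInferenceFixedPoint H γ W x y v) {l : ℕ} (hl : l ≤ H) :
    ‖v l - forward W x l‖
      ≤ l * (1 + √C) ^ l * (γ H * B * (√(C / M) * ‖y - forward W x (H + 1)‖)) := by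
  have hH0 := hpos H le_rfl
  have hC := Real.sqrt_nonneg C
  have hres := hv.residual_eq hpos
  have hle : ‖localError W v H‖ ≤ ‖y - forward W x (H + 1)‖ := by
    rw [hres]; exact norm_le_norm_add_precond hpos _
  set D := γ H * B * (√(C / M) * ‖y - forward W x (H + 1)‖) with hD
  have herr : ∀ l < H, ‖localError W v l‖ ≤ D := by
    intro l hl
    have hl0 := hpos l hl.le
    rw [hv.error_eq' hpos hl.le, norm_smul, Real.norm_of_nonneg (by positivity), div_eq_mul_inv, hD]
    have h1 := hB l hl
    have h2 : (0 : ℝ) ≤ B := (inv_pos.2 hl0).le.trans h1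
    gcongr
    exact (hW.norm_backward_le hl _).trans (by gcongr)
  induction l with
  | zero => simp [forward, weightProd_self, hv.1]
  | succ l ih =>
    have hD0 : 0 ≤ D := (norm_nonneg _).trans (herr l hl)
    -- The deviation obeys the forward recursion driven by the local errors. It starts from 0, so no
    -- bound on the input layer is needed.
    have e : v (l + 1) - forward W x (l + 1)
        = W l * (v l - forward W x l) + localError W v l := by
      rw [localError, forward, forward, weightProd_succ W (Nat.zero_le l), Matrix.mul_sub,
        Matrix.mul_assoc]
      abel
    have h1 : ‖W l * (v l - forward W x l)‖ ≤ √C * (l * (1 + √C) ^ l * D) := by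
      rcases Nat.eq_zero_or_pos l with rfl | h1
      · simp [forward, weightProd_self, hv.1]
      · exact (le_sqrt_mul_of_sq_le (norm_nonneg _) (hW.hidden l h1 hl _ _)).trans
          (mul_le_mul_of_nonneg_left (ih (by omega)) hC)
    rw [e]
    refine (norm_add_le _ _).trans ((add_le_add h1 (herr l hl)).trans ?_)
    have h2 : (1 : ℝ) ≤ (1 + √C) ^ (l + 1) := one_le_pow₀ (by linarith)
    have h3 : √C * (1 + √C) ^ l ≤ (1 + √C) ^ (l + 1) := by
      rw [pow_succ']
      gcongr
      linarith
    push_cast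
    calc √C * (l * (1 + √C) ^ l * D) + D = (l * (√C * (1 + √C) ^ l) + 1) * D := by ring
      _ ≤ (l * (1 + √C) ^ (l + 1) + (1 + √C) ^ (l + 1)) * D := by gcongr
      _ = _ := by ring

/-- Product rule for differences: p vᵀ - q uᵀ = (p - q)vᵀ + q(v - u)ᵀ. -/
theorem norm_pcGrad_sub_le (hγ : 0 ≤ γ H) (hv : IsInferenceFixedPoint H γ W x y v) {l : ℕ}
    (hl : l ≤ H) : ‖pcGrad H γ y v W l - γ H • gdGrad H x y W l‖
      ≤ ‖γ l • localError W v l - γ H • backpropError H x y W l‖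
          * (‖forward W x l‖ + ‖v l - forward W x l‖)
        + γ H * ‖backpropError H x y W l‖ * ‖v l - forward W x l‖ := by
  have e : pcGrad H γ y v W l - γ H • gdGrad H x y W l
      = -((γ l • localError W v l - γ H • backpropError H x y W l) * (v l)ᵀ)
        + -((γ H • backpropError H x y W l) * (v l - forward W x l)ᵀ) := by
    rw [pcGrad_eq hv.2.1 hl, gdGrad_eq hl, Matrix.sub_mul, Matrix.transpose_sub, Matrix.mul_sub,
      smul_neg, Matrix.smul_mul _ _ (forward W x l)ᵀ]
    abel
  rw [e]
  refine (norm_add_le _ _).trans (add_le_add ?_ ?_)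
  · rw [norm_neg]
    refine (Matrix.frobenius_norm_mul _ _).trans (mul_le_mul_of_nonneg_left ?_ (norm_nonneg _))
    rw [Matrix.frobenius_norm_transpose]
    calc ‖v l‖ = ‖forward W x l + (v l - forward W x l)‖ := by rw [add_sub_cancel]
      _ ≤ _ := norm_add_le _ _
  · rw [norm_neg]
    refine (Matrix.frobenius_norm_mul _ _).trans (le_of_eq ?_)
    rw [Matrix.frobenius_norm_transpose, norm_smul, Real.norm_of_nonneg hγ]

/-- The gradient is minus the backward product applied to (y - f)u_lᵀ. Conditioning of the backward
pass compares it with δ_l, and the forward pass does not shrink norms once cM ≥ 1, so u_l may be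
replaced by x. -/
theorem WellConditioned.le_norm_gdGrad (hW : WellConditioned H M W c C) (hc : 0 < c) (hM : 1 ≤ M)
    (hcM : 1 ≤ c * M) {l : ℕ} (hl : l ≤ H) :
    ‖backpropError H x y W l‖ * ‖(y - forward W x (H + 1)) * xᵀ‖
      ≤ (1 + √(C / c)) * ‖y - forward W x (H + 1)‖ * ‖gdGrad H x y W l‖ := by
  set R := y - forward W x (H + 1) with hR
  have h1 := hW.backward_mul_le hc hM hl (R * (forward W x l)ᵀ) R
  have h2 : ‖R * xᵀ‖ ≤ ‖R * (forward W x l)ᵀ‖ := by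
    rcases Nat.eq_zero_or_pos l with rfl | h0
    · rw [forward, weightProd_self, Matrix.one_mul]
    · have h3 := hW.forward_lower l h0 hl _ (x * Rᵀ)
      have e1 : ‖R * xᵀ‖ = ‖x * Rᵀ‖ := by
        rw [← Matrix.frobenius_norm_transpose, Matrix.transpose_mul, Matrix.transpose_transpose]
      have e2 : ‖R * (forward W x l)ᵀ‖ = ‖weightProd W l 0 * (x * Rᵀ)‖ := by
        rw [← Matrix.frobenius_norm_transpose, Matrix.transpose_mul, Matrix.transpose_transpose,
          forward, Matrix.mul_assoc]
      rw [e1, e2]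
      refine (pow_le_pow_iff_left₀ (norm_nonneg _) (norm_nonneg _) two_ne_zero).1 (le_trans ?_ h3)
      exact le_mul_of_one_le_left (sq_nonneg _) hcM
  have e3 : ‖gdGrad H x y W l‖ = ‖(weightProd W (H + 1) (l + 1))ᵀ * (R * (forward W x l)ᵀ)‖ := by
    rw [gdGrad_eq hl, norm_neg, backpropError, Matrix.mul_assoc]
  calc _ ≤ ‖backpropError H x y W l‖ * ‖R * (forward W x l)ᵀ‖ := by gcongr
    _ ≤ _ := h1
    _ = _ := by rw [e3]; ring

end Bounds

/-! ### Root mean squares against Frobenius norms -/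

section RootMeanSquare

theorem rms_nonneg {p q : ℕ} (A : Matrix (Fin p) (Fin q) ℝ) : 0 ≤ rms A :=
  div_nonneg (norm_nonneg _) (Real.sqrt_nonneg _)

theorem sqrt_mul_rms_le {p q : ℕ} (A : Matrix (Fin p) (Fin q) ℝ) : √p * rms A ≤ ‖A‖ := by
  rcases Nat.eq_zero_or_pos q with rfl | hq
  · simp [rms]
  have hq' : (1 : ℝ) ≤ √q := Real.one_le_sqrt.2 (by exact_mod_cast hq)
  rcases Nat.eq_zero_or_pos p with rfl | hp
  · simp
  have hp' : (0 : ℝ) < √p := Real.sqrt_pos.2 (by exact_mod_cast hp)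
  rw [rms, Real.sqrt_mul (Nat.cast_nonneg p), ← mul_div_assoc, div_le_iff₀ (by positivity)]
  have := mul_le_mul_of_nonneg_left hq' (mul_nonneg hp'.le (norm_nonneg A))
  linarith

theorem rms_le_norm {p q : ℕ} (A : Matrix (Fin p) (Fin q) ℝ) : rms A ≤ ‖A‖ := by
  rcases Nat.eq_zero_or_pos p with rfl | hp
  · simp [rms]
  have hp' : (1 : ℝ) ≤ √p := Real.one_le_sqrt.2 (by exact_mod_cast hp)
  exact (le_mul_of_one_le_left (rms_nonneg A) hp').trans (sqrt_mul_rms_le A)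

end RootMeanSquare

/-! ### Norms of the embedded data -/

section Data

theorem norm_submatrix_cast {p q p' q' : ℕ} (A : Matrix (Fin p) (Fin q) ℝ) (hp : p' = p)
    (hq : q' = q) : ‖A.submatrix (Fin.cast hp) (Fin.cast hq)‖ = ‖A‖ := by
  subst hp hq
  rfl

theorem norm_inputData (H m M : ℕ) {d N : ℕ} (x : Matrix (Fin d) (Fin N) ℝ) :
    ‖inputData H m M x‖ = ‖x‖ :=
  norm_submatrix_cast x (width_zero H d m M) rfl

theorem norm_outputData (H d M : ℕ) {m N : ℕ} (y : Matrix (Fin m) (Fin N) ℝ) :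
    ‖outputData H d M y‖ = ‖y‖ :=
  norm_submatrix_cast y (width_last H d m M) rfl

theorem norm_outputData_mul_inputData (H M : ℕ) {d m N : ℕ} (x : Matrix (Fin d) (Fin N) ℝ)
    (y : Matrix (Fin m) (Fin N) ℝ) :
    ‖outputData H d M y * (inputData H m M x)ᵀ‖ = ‖y * xᵀ‖ :=
  norm_submatrix_cast (y * xᵀ) (width_last H d m M) (width_zero H d m M)

end Data

end PCNet

/-! ### Passage to the limit of large width -/

namespace PCNet

theorem isLittleO_of_le_mul {f g e : ℕ → ℝ} (he : Tendsto e atTop (𝓝 0)) (hf : ∀ M, 0 ≤ f M)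
    (hg : ∀ M, 0 ≤ g M) (h : ∀ᶠ M in atTop, f M ≤ e M * g M) : f =o[atTop] g := by
  rw [isLittleO_iff]
  intro ε hε
  filter_upwards [h, he.eventually_le_const hε] with M h1 h2
  rw [Real.norm_of_nonneg (hf M), Real.norm_of_nonneg (hg M)]
  exact h1.trans (mul_le_mul_of_nonneg_right h2 (hg M))

theorem tendsto_const_mul_inv_sqrt (K : ℝ) :
    Tendsto (fun M : ℕ => K * (√(M : ℝ))⁻¹) atTop (𝓝 0) := by
  rw [← mul_zero K]
  exact (tendsto_inv_atTop_zero.comp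
    (Real.tendsto_sqrt_atTop.comp tendsto_natCast_atTop_atTop)).const_mul _

/-- Bounds on the step sizes of all layers, from bounds on each. -/
theorem exists_step_bound {H : ℕ} {γ : ℕ → ℕ → ℝ} (hpos : ∀ M, ∀ l ≤ H, 0 < γ M l)
    (hγ : ∀ l < H, (fun M => γ M l) =Θ[atTop] fun _ => (1 : ℝ)) :
    ∃ B : ℝ, 0 < B ∧ ∀ᶠ M in atTop, ∀ l < H, γ M l ≤ B ∧ (γ M l)⁻¹ ≤ B := by
  have h : ∀ l, ∃ b : ℝ, 0 ≤ b ∧ (l < H → ∀ᶠ M in atTop, γ M l ≤ b ∧ (γ M l)⁻¹ ≤ b) := by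
    intro l
    by_cases hl : l < H
    · obtain ⟨b₁, h1⟩ := (hγ l hl).1.bound
      obtain ⟨b₂, h2⟩ := (hγ l hl).2.bound
      refine ⟨max 0 (max b₁ b₂), le_max_left _ _, fun _ => ?_⟩
      filter_upwards [h1, h2] with M h1 h2
      have h0 := hpos M l hl.le
      rw [norm_one, mul_one, Real.norm_of_nonneg h0.le] at h1
      rw [norm_one, Real.norm_of_nonneg h0.le] at h2
      exact ⟨h1.trans (by simp), ((inv_le_iff_one_le_mul₀ h0).2 h2).trans (by simp)⟩
    · exact ⟨0, le_rfl, fun h => absurd h hl⟩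
  choose b hb0 hb using h
  -- The sum dominates every nonnegative b l; adding 1 keeps the bound positive.
  refine ⟨∑ l ∈ Finset.range H, b l + 1,
    add_pos_of_nonneg_of_pos (Finset.sum_nonneg fun l _ => hb0 l) one_pos, ?_⟩
  have := (Filter.eventually_all_finset (l := atTop) (Finset.range H)
    (p := fun l M => γ M l ≤ b l ∧ (γ M l)⁻¹ ≤ b l)).2 fun l hl => hb l (Finset.mem_range.1 hl)
  filter_upwards [this] with M hM l hl
  have h1 := hM l (Finset.mem_range.2 hl)
  have h2 : b l ≤ ∑ l ∈ Finset.range H, b l :=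
    Finset.single_le_sum (fun l _ => hb0 l) (Finset.mem_range.2 hl)
  exact ⟨by linarith [h1.1], by linarith [h1.2]⟩

section Limits

variable {H d m N : ℕ} {x : Matrix (Fin d) (Fin N) ℝ} {y : Matrix (Fin m) (Fin N) ℝ}
  {W : ∀ M, Weights (width H d m M)} {γ : ℕ → ℕ → ℝ} {c C B : ℝ}
  {v : ∀ M, States (width H d m M) N} {l : ℕ}

/-- The finite-width estimates behind the limits. -/
theorem exists_eventually_bounds (hc : 0 < c) (hC : 0 < C) (hB0 : 0 < B)
    (hwc : ∀ᶠ M in atTop, WellConditioned H M (W M) c C)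
    (hout : Tendsto (fun M => ‖weightProd (W M) (H + 1) 0‖) atTop (𝓝 0))
    (hpos : ∀ M, ∀ l ≤ H, 0 < γ M l) (hB : ∀ᶠ M in atTop, ∀ l < H, γ M l ≤ B ∧ (γ M l)⁻¹ ≤ B)
    (hBH : ∀ᶠ M in atTop, γ M H ≤ B)
    (hv : ∀ M, IsInferenceFixedPoint H (γ M) (W M) (inputData H m M x) (outputData H d M y) (v M))
    (hl : l ≤ H) :
    ∃ K : ℝ, 0 ≤ K ∧ (∀ᶠ M : ℕ in atTop,
      ‖γ M l • localError (W M) (v M) l -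
          γ M H • backpropError H (inputData H m M x) (outputData H d M y) (W M) l‖
        ≤ K * (√M)⁻¹ * ‖backpropError H (inputData H m M x) (outputData H d M y) (W M) l‖ ∧
      ‖v M l - forward (W M) (inputData H m M x) l‖ ≤ K * (√M)⁻¹ ∧
      ‖pcGrad H (γ M) (outputData H d M y) (v M) (W M) l -
          γ M H • gdGrad H (inputData H m M x) (outputData H d M y) (W M) l‖
        ≤ K * (√M)⁻¹ * ‖backpropError H (inputData H m M x) (outputData H d M y) (W M) l‖ ∧
      (if l < H then √M else 1) *
        ‖backpropError H (inputData H m M x) (outputData H d M y) (W M) l‖ ≤ K) ∧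
      (y * xᵀ ≠ 0 → ∀ᶠ M : ℕ in atTop,
        ‖backpropError H (inputData H m M x) (outputData H d M y) (W M) l‖
          ≤ K * ‖gdGrad H (inputData H m M x) (outputData H d M y) (W M) l‖) := by
  -- ρ bounds the residual once ‖f‖ ≤ 1, and κ is the condition number. K₁ to K₄ control C_γ, the
  -- errors, the states and the gradients; K₅ is the size of δ_l, and K₆ compares δ_l with the
  -- gradient.
  set ρ : ℝ := ‖y‖ + 1 with hρ
  set κ : ℝ := 1 + √(C / c) with hκ
  set K₁ : ℝ := H * (B * B * (C * m)) with hK₁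
  set K₂ : ℝ := B * κ * K₁ with hK₂
  set K₃ : ℝ := H * (1 + √C) ^ H * (B * B * (√C * ρ)) with hK₃
  set K₄ : ℝ := K₂ * ((1 + √C) * ‖x‖ + K₃) + B * K₃ with hK₄
  set K₅ : ℝ := (√C + 1) * ρ with hK₅
  set K₆ : ℝ := κ * ρ / (‖y * xᵀ‖ / 2) with hK₆
  have hρ0 : 0 < ρ := by positivity
  have hκ0 : 0 < κ := by positivity
  have hK₁0 : 0 ≤ K₁ := by positivity
  have hK₂0 : 0 ≤ K₂ := by positivity
  have hK₃0 : 0 ≤ K₃ := by positivity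
  have hK₄0 : 0 ≤ K₄ := by positivity
  have hK₅0 : 0 ≤ K₅ := by positivity
  have hK₆0 : 0 ≤ K₆ := by positivity
  have hf : Tendsto (fun M => ‖forward (W M) (inputData H m M x) (H + 1)‖) atTop (𝓝 0) := by
    refine squeeze_zero (fun M => norm_nonneg _)
      (g := fun M => ‖weightProd (W M) (H + 1) 0‖ * ‖x‖) (fun M => ?_) ?_
    · rw [← norm_inputData H m M x]
      exact Matrix.frobenius_norm_mul _ _
    · simpa using hout.mul_const ‖x‖
  have hR : ∀ᶠ M in atTop,
      ‖outputData H d M y - forward (W M) (inputData H m M x) (H + 1)‖ ≤ ρ := by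
    filter_upwards [hf.eventually_le_const one_pos] with M hM
    refine (norm_sub_le _ _).trans ?_
    rw [norm_outputData, hρ]
    linarith
  refine ⟨K₂ + K₃ + K₄ + K₅ + K₆, by positivity, ?_, fun hyx => ?_⟩
  · filter_upwards [hwc, hB, hBH, hR, eventually_ge_atTop 1] with M hwc hB hBH hR hM
    have hM0 : (0 : ℝ) < M := by exact_mod_cast hM
    have hMs : (1 : ℝ) ≤ √M := Real.one_le_sqrt.2 (by exact_mod_cast hM)
    have hMs0 : (0 : ℝ) < √M := by linarith
    set t : ℝ := (√M)⁻¹ with ht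
    have ht0 : 0 < t := by positivity
    have ht1 : t ≤ 1 := inv_le_one_of_one_le₀ hMs
    have htM : (M : ℝ)⁻¹ = t * t := by
      rw [ht, ← mul_inv, Real.mul_self_sqrt hM0.le]
    have htt : t * t ≤ t := mul_le_of_le_one_right ht0.le ht1
    have hH0 := hpos M H le_rfl
    set δ := ‖backpropError H (inputData H m M x) (outputData H d M y) (W M) l‖ with hδ
    have hδ0 : 0 ≤ δ := norm_nonneg _
    have hpre : ‖precond H (γ M) (W M)‖ ≤ K₁ * t := by
      have e : ((width H d m M (H + 1) : ℕ) : ℝ) = m := by rw [width_last]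
      refine (hwc.norm_precond_le (hpos M) fun l hl => (hB l hl).2).trans ?_
      rw [e, div_eq_mul_inv, htM]
      calc H * (γ M H * B * (C * (t * t) * m)) ≤ H * (B * B * (C * t * m)) := by gcongr
        _ = K₁ * t := by rw [hK₁]; ring
    have h1 : ‖γ M l • localError (W M) (v M) l -
          γ M H • backpropError H (inputData H m M x) (outputData H d M y) (W M) l‖
        ≤ K₂ * t * δ := by
      refine (hwc.norm_error_sub_le hc hM (hpos M) (hv M) hl).trans ?_
      calc γ M H * (1 + √(C / c)) * ‖precond H (γ M) (W M)‖ * δ ≤ B * κ * (K₁ * t) * δ := by gcongr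
        _ = K₂ * t * δ := by rw [hK₂]; ring
    have h2 : ‖v M l - forward (W M) (inputData H m M x) l‖ ≤ K₃ * t := by
      refine (hwc.norm_state_sub_le (hpos M) (fun l hl => (hB l hl).2) (hv M) hl).trans ?_
      have e : √(C / M) = √C * t := by
        rw [Real.sqrt_div hC.le, div_eq_mul_inv]
      have h3 : (1 + √C) ^ l ≤ (1 + √C) ^ H :=
        pow_le_pow_right₀ (by linarith [Real.sqrt_nonneg C]) hl
      rw [e]
      calc _ ≤ H * (1 + √C) ^ H * (B * B * (√C * t * ρ)) := by gcongr
        _ = K₃ * t := by rw [hK₃]; ring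
    have h3 : ‖pcGrad H (γ M) (outputData H d M y) (v M) (W M) l -
          γ M H • gdGrad H (inputData H m M x) (outputData H d M y) (W M) l‖ ≤ K₄ * t * δ := by
      refine (norm_pcGrad_sub_le hH0.le (hv M) hl).trans ?_
      have h4 : ‖forward (W M) (inputData H m M x) l‖ ≤ (1 + √C) * √M * ‖x‖ := by
        rw [← norm_inputData H m M x]
        exact hwc.norm_forward_le hM hl
      -- Here the full rate 1/M = t² is kept, since multiplying by the forward state costs √M.
      have h5 : ‖γ M l • localError (W M) (v M) l -
          γ M H • backpropError H (inputData H m M x) (outputData H d M y) (W M) l‖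
          ≤ K₂ * (t * t) * δ := by
        refine (hwc.norm_error_sub_le hc hM (hpos M) (hv M) hl).trans ?_
        have e : ((width H d m M (H + 1) : ℕ) : ℝ) = m := by rw [width_last]
        have hpre' := hwc.norm_precond_le (hpos M) fun l hl => (hB l hl).2
        rw [e, div_eq_mul_inv, htM] at hpre'
        calc γ M H * (1 + √(C / c)) * ‖precond H (γ M) (W M)‖ * δ
            ≤ B * κ * (H * (B * B * (C * (t * t) * m))) * δ := by
              gcongr
              exact hpre'.trans (by gcongr)
          _ = K₂ * (t * t) * δ := by rw [hK₂, hK₁]; ring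
      have h6 : t * √M = 1 := inv_mul_cancel₀ hMs0.ne'
      calc _ ≤ K₂ * (t * t) * δ * ((1 + √C) * √M * ‖x‖ + K₃ * t) + B * δ * (K₃ * t) := by gcongr
        _ = (K₂ * ((1 + √C) * (t * √M) * ‖x‖ + K₃ * (t * t)) + B * K₃) * t * δ := by ring
        _ ≤ (K₂ * ((1 + √C) * 1 * ‖x‖ + K₃ * 1) + B * K₃) * t * δ := by
          rw [h6]
          gcongr
          exact htt.trans ht1
        _ = K₄ * t * δ := by rw [hK₄]; ring
    have h4 : (if l < H then √M else 1) * δ ≤ K₅ := by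
      split_ifs with hlH
      · have h := hwc.norm_backward_le hlH
          (outputData H d M y - forward (W M) (inputData H m M x) (H + 1))
        rw [Real.sqrt_div hC.le] at h
        calc √M * δ ≤ √M * (√C / √M * ρ) := by
              refine mul_le_mul_of_nonneg_left (h.trans ?_) hMs0.le
              gcongr
          _ = √C * ρ := by field_simp
          _ ≤ K₅ := by rw [hK₅]; gcongr; linarith
      · obtain rfl : l = H := by omega
        have e : δ = ‖outputData l d M y - forward (W M) (inputData l m M x) (l + 1)‖ := by
          rw [hδ, backpropError, weightProd_self, Matrix.transpose_one, Matrix.one_mul]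
        rw [one_mul, e]
        refine hR.trans ?_
        rw [hK₅]
        exact le_mul_of_one_le_left hρ0.le (by linarith [Real.sqrt_nonneg C])
    refine ⟨h1.trans ?_, h2.trans ?_, h3.trans ?_, h4.trans ?_⟩
    · gcongr; linarith
    · gcongr; linarith
    · gcongr; linarith
    · linarith
  · have hyx0 : 0 < ‖y * xᵀ‖ / 2 := half_pos (norm_pos_iff.2 hyx)
    -- As f → 0, at least half of ‖yxᵀ‖ survives in (y - f)xᵀ.
    have hfx : ∀ᶠ M in atTop,
        ‖forward (W M) (inputData H m M x) (H + 1)‖ * ‖x‖ ≤ ‖y * xᵀ‖ / 2 := by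
      have := hf.mul_const ‖x‖
      rw [zero_mul] at this
      exact this.eventually_le_const hyx0
    have hcM : ∀ᶠ M : ℕ in atTop, 1 ≤ c * M :=
      (tendsto_natCast_atTop_atTop.const_mul_atTop hc).eventually_ge_atTop 1
    filter_upwards [hwc, hR, hfx, hcM, eventually_ge_atTop 1] with M hwc hR hfx hcM hM
    have h1 := hwc.le_norm_gdGrad hc hM hcM (x := inputData H m M x) (y := outputData H d M y) hl
    have h2 : ‖y * xᵀ‖ / 2 ≤ ‖(outputData H d M y - forward (W M) (inputData H m M x) (H + 1))
        * (inputData H m M x)ᵀ‖ := by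
      have h3 : ‖forward (W M) (inputData H m M x) (H + 1) * (inputData H m M x)ᵀ‖
          ≤ ‖y * xᵀ‖ / 2 := by
        refine (Matrix.frobenius_norm_mul _ _).trans ?_
        rwa [Matrix.frobenius_norm_transpose, norm_inputData]
      have h4 := norm_sub_norm_le (outputData H d M y * (inputData H m M x)ᵀ)
        (forward (W M) (inputData H m M x) (H + 1) * (inputData H m M x)ᵀ)
      rw [norm_outputData_mul_inputData, ← Matrix.sub_mul] at h4
      linarith
    have h5 : ‖backpropError H (inputData H m M x) (outputData H d M y) (W M) l‖
        ≤ K₆ * ‖gdGrad H (inputData H m M x) (outputData H d M y) (W M) l‖ := by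
      rw [hK₆, div_mul_eq_mul_div, le_div_iff₀ hyx0]
      refine (mul_le_mul_of_nonneg_left h2 (norm_nonneg _)).trans (h1.trans ?_)
      gcongr
    refine h5.trans ?_
    gcongr
    linarith

end Limits

end PCNet

theorem corollary4p3 {Ω : Type*} [MeasurableSpace Ω] (μ : Measure Ω) [IsProbabilityMeasure μ]
    -- `H ≥ 1` hidden layers, i.e. `L = H + 1 ≥ 2` weight matrices; fixed input and output dimensions
    (H d m N : ℕ) (hH : 1 ≤ H) (hm : 1 ≤ m)
    (x : Matrix (Fin d) (Fin N) ℝ) (y : Matrix (Fin m) (Fin N) ℝ)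
    -- random weights given by the maximal update parameterization, for each hidden width `M`
    (σ : ℝ) (hσ : 0 < σ) (a b : ℕ → ℝ) (hab : IsMuPScale H a b)
    (w : ∀ M : ℕ, Ω → Weights (width H d m M)) (hw : IsGaussianInit μ H d m σ b w)
    (W : ∀ M : ℕ, Ω → Weights (width H d m M)) (hW : ∀ M ω, W M ω = scaledWeights M a (w M ω))
    -- inference step sizes, with `γ_l = Θ(1)` for `l < L`
    (γ : ℕ → ℕ → ℝ) (hpos : ∀ M, ∀ l ≤ H, 0 < γ M l)
    (hγ : ∀ l < H, (fun M => γ M l) =Θ[atTop] fun _ => (1 : ℝ)) :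
    -- the inference phase has exactly one fixed point
    (∀ M ω, ∃ v : States (width H d m M) N,
      IsInferenceFixedPoint H (γ M) (W M ω) (inputData H m M x) (outputData H d M y) v ∧
      ∀ v' : States (width H d m M) N,
        IsInferenceFixedPoint H (γ M) (W M ω) (inputData H m M x) (outputData H d M y) v' →
        ∀ l ≤ H + 1, v' l = v l) ∧
    -- `γ_L = Θ(1)`
    (((fun M => γ M H) =Θ[atTop] fun _ => (1 : ℝ)) →
      (∃ K : ℝ, ∀ᵐ ω ∂μ, ∀ᶠ M : ℕ in atTop, ‖precond H (γ M) (W M ω)‖ ≤ K / (M : ℝ)) ∧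
      ∀ v : ∀ M : ℕ, Ω → States (width H d m M) N,
        (∀ M ω, IsInferenceFixedPoint H (γ M) (W M ω) (inputData H m M x) (outputData H d M y)
          (v M ω)) →
        ∀ l ≤ H, ∀ᵐ ω ∂μ,
          -- the errors become the backpropagated errors
          ((fun M : ℕ => ‖γ M l • localError (W M ω) (v M ω) l -
              γ M H • backpropError H (inputData H m M x) (outputData H d M y) (W M ω) l‖)
            =o[atTop] fun M : ℕ =>
              ‖backpropError H (inputData H m M x) (outputData H d M y) (W M ω) l‖) ∧
          -- the states become those of the forward pass
          Tendsto (fun M : ℕ => rms (v M ω l - forward (W M ω) (inputData H m M x) l))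
            atTop (𝓝 0) ∧
          -- the gradient becomes `γ_L` times that of gradient descent, first on the scale of the
          -- latter (entries of order `1 / M`, or `1` in the last layer), then relative to it
          Tendsto (fun M : ℕ => (if l < H then (M : ℝ) else 1) *
              rms (pcGrad H (γ M) (outputData H d M y) (v M ω) (W M ω) l -
                γ M H • gdGrad H (inputData H m M x) (outputData H d M y) (W M ω) l))
            atTop (𝓝 0) ∧
          (y * xᵀ ≠ 0 →
            (fun M : ℕ => ‖pcGrad H (γ M) (outputData H d M y) (v M ω) (W M ω) l -
                γ M H • gdGrad H (inputData H m M x) (outputData H d M y) (W M ω) l‖)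
              =o[atTop] fun M : ℕ =>
                ‖gdGrad H (inputData H m M x) (outputData H d M y) (W M ω) l‖)) ∧
    -- `γ_L = Θ(M)`
    (((fun M => γ M H) =Θ[atTop] fun M : ℕ => (M : ℝ)) →
      ∃ c K : ℝ, 0 < c ∧ ∀ᵐ ω ∂μ, ∀ᶠ M : ℕ in atTop,
        c ≤ ‖precond H (γ M) (W M ω)‖ ∧ ‖precond H (γ M) (W M ω)‖ ≤ K) := by
  obtain ⟨s, hs, hG⟩ := exists_isGaussianNet (σ := σ) hab hw hW
  obtain ⟨c, C, hc, hC, hwc⟩ := exists_ae_wellConditioned hσ hs hG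
  have hout := ae_tendsto_weightProd_zero hH hσ hs hG
  obtain ⟨B, hB0, hB⟩ := exists_step_bound hpos hγ
  have hml : ∀ M, ((width H d m M (H + 1) : ℕ) : ℝ) = m := fun M => by rw [width_last]
  refine ⟨fun M ω => ?_, fun hγH => ⟨?_, fun v hv l hl => ?_⟩, fun hγH => ?_⟩
  · obtain ⟨v, hv⟩ := exists_isInferenceFixedPoint (W := W M ω) (hpos M) (inputData H m M x)
      (outputData H d M y)
    exact ⟨v, hv, fun v' hv' l hl => hv.unique (hpos M) hv' hl⟩
  · obtain ⟨b, hb⟩ := hγH.1.bound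
    refine ⟨H * (b * B * (C * m)), ?_⟩
    filter_upwards [hwc] with ω hwc
    filter_upwards [hwc, hB, hb] with M hwc hB hb
    have hH0 := hpos M H le_rfl
    rw [norm_one, mul_one, Real.norm_of_nonneg hH0.le] at hb
    have h := hwc.norm_precond_le (hpos M) fun l hl => (hB l hl).2
    rw [hml] at h
    calc _ ≤ _ := h
      _ ≤ H * (b * B * (C / M * m)) := by gcongr
      _ = _ := by ring
  · obtain ⟨b, hb⟩ := hγH.1.bound
    -- One constant is made to bound γ_L as well.
    have hB' : ∀ᶠ M in atTop, ∀ l < H, γ M l ≤ max b B ∧ (γ M l)⁻¹ ≤ max b B := by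
      filter_upwards [hB] with M hM l hl
      exact ⟨(hM l hl).1.trans (le_max_right _ _), (hM l hl).2.trans (le_max_right _ _)⟩
    have hBH : ∀ᶠ M in atTop, γ M H ≤ max b B := by
      filter_upwards [hb] with M hb
      rw [norm_one, mul_one, Real.norm_of_nonneg (hpos M H le_rfl).le] at hb
      exact hb.trans (le_max_left _ _)
    filter_upwards [hwc, hout] with ω hwc hout
    obtain ⟨K, hK0, hev, hgd⟩ := exists_eventually_bounds (y := y) hc hC
      (hB0.trans_le (le_max_right b B)) hwc hout hpos hB' hBH (fun M => hv M ω) hl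
    have hlim := tendsto_const_mul_inv_sqrt
    refine ⟨?_, ?_, ?_, fun hyx => ?_⟩
    · refine isLittleO_of_le_mul (hlim K) (fun M => norm_nonneg _) (fun M => norm_nonneg _) ?_
      filter_upwards [hev] with M hM using hM.1
    · refine squeeze_zero' (Eventually.of_forall fun M => rms_nonneg _) ?_ (hlim K)
      filter_upwards [hev] with M hM using (rms_le_norm _).trans hM.2.1
    · refine squeeze_zero' (Eventually.of_forall fun M => mul_nonneg (by split_ifs <;> positivity)
        (rms_nonneg _)) ?_ (hlim (K * K))
      filter_upwards [hev, eventually_ge_atTop 1] with M hM hM1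
      obtain ⟨-, -, h3, h4⟩ := hM
      have hM0 : (0 : ℝ) < M := by exact_mod_cast hM1
      have hMs : 0 < √(M : ℝ) := Real.sqrt_pos.2 hM0
      have hM2 : (M : ℝ) = √M * √M := (Real.mul_self_sqrt hM0.le).symm
      split_ifs at h4 ⊢ with hlH
      · have h5 := sqrt_mul_rms_le (pcGrad H (γ M) (outputData H d M y) (v M ω) (W M ω) l -
          γ M H • gdGrad H (inputData H m M x) (outputData H d M y) (W M ω) l)
        have e : ((width H d m M (l + 1) : ℕ) : ℝ) = M := by rw [width_hidden (by omega) hlH]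
        rw [e] at h5
        -- Of M = √M · √M, one factor is absorbed by the M rows in the root mean square, the other
        -- by δ_l = O(1/√M); the relative error 1/√M remains.
        nth_rw 1 [hM2]
        rw [mul_assoc]
        refine (mul_le_mul_of_nonneg_left (h5.trans h3) hMs.le).trans ?_
        calc √(M : ℝ) * (K * (√M)⁻¹ *
              ‖backpropError H (inputData H m M x) (outputData H d M y) (W M ω) l‖)
            = K * (√M)⁻¹ * (√M *
              ‖backpropError H (inputData H m M x) (outputData H d M y) (W M ω) l‖) := by ring
          _ ≤ K * (√M)⁻¹ * K := by gcongr
          _ = _ := by ring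
      · rw [one_mul] at h4 ⊢
        refine (rms_le_norm _).trans (h3.trans ?_)
        calc _ ≤ K * (√(M : ℝ))⁻¹ * K := by gcongr
          _ = _ := by ring
    · refine isLittleO_of_le_mul (hlim (K * K)) (fun M => norm_nonneg _)
        (fun M => norm_nonneg _) ?_
      filter_upwards [hev, hgd hyx] with M hM hgd
      refine hM.2.2.1.trans ?_
      calc _ ≤ K * (√(M : ℝ))⁻¹ *
            (K * ‖gdGrad H (inputData H m M x) (outputData H d M y) (W M ω) l‖) := by gcongr
        _ = _ := by ring
  · obtain ⟨b₁, hb₁, h1⟩ := hγH.1.exists_pos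
    obtain ⟨b₂, hb₂, h2⟩ := hγH.2.exists_pos
    -- M / b₂ ≤ γ_L ≤ b₁ M cancels the factor 1/M of the backward products on either side.
    refine ⟨c / (b₂ * B), H * (b₁ * B * (C * m)), by positivity, ?_⟩
    filter_upwards [hwc] with ω hwc
    filter_upwards [hwc, hB, h1.bound, h2.bound, eventually_ge_atTop 1] with M hwc hB h1 h2 hM
    have hM0 : (0 : ℝ) < M := by exact_mod_cast hM
    have hH0 := hpos M H le_rfl
    rw [Real.norm_of_nonneg hH0.le, Real.norm_of_nonneg hM0.le] at h1 h2
    constructor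
    · refine le_trans ?_ (hwc.le_norm_precond hH (by rw [width_last]; exact hm) (hpos M)
        (hB 0 hH).1)
      calc c / (b₂ * B) = (M / b₂) / B * (c / M) := by field_simp
        _ ≤ γ M H / B * (c / M) := by
          have : M / b₂ ≤ γ M H := by rw [div_le_iff₀ hb₂]; linarith
          gcongr
    · have h := hwc.norm_precond_le (hpos M) fun l hl => (hB l hl).2
      rw [hml] at h
      calc _ ≤ _ := h
        _ ≤ H * (b₁ * M * B * (C / M * m)) := by gcongr
        _ = _ := by field_simp
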